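/- Let $d\ge 2$ and let $M(d,d)$ be the space of real $d\times d$ matrices with the Frobenius norm $\|q\|^2=\sum_{i,j}q_{ij}^2$. Let $\Sigma=\{q\in M(d,d):\det q=0\}$ and let $S(q)=\operatorname{sign}(\det q)\,\operatorname{dist}(q,\Sigma)$ be the signed distance to $\Sigma$ (so $S=0$ on $\Sigma$). Let $\sigma_1(q)\ge\dots\ge\sigma_d(q)\ge 0$ denote the singular values of $q$. Let $\operatorname{Sing}(S)$ be the set of all points $q\in M(d,d)$ at which $S$ is not smooth ($C^\infty$). Then: 1. $S$ is smooth at every $q\in M(d,d)$ whose two smallest singular values are distinct, $\sigma_{d-1}(q)\neq\sigma_d(q)$. 2. $\operatorname{Sing}(S)$ is exactly the complementary set, $\operatorname{Sing}(S)=\{q:\sigma_{d-1}(q)=\sigma_d(q)\}$. Equivalently, $\operatorname{Sing}(S)$ is the set of all $q$ that can be written $q=g_1\,\mathrm{diag}(x_1,\dots,x_d)\,g_2$ with $g_1,g_2\in SO(d)$, $x_1\ge\dots\ge x_{d-1}\ge|x_d|$ and $x_{d-1}=|x_d|$. 3. $\operatorname{Sing}(S)$ is a semialgebraic subset of $M(d,d)\cong\mathbb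 R^{d^2}$ of codimension $2$, that is, of (Hausdorff) dimension $d^2-2$. -/

import Mathlib

open scoped ContDiff Matrix

/- Matrices carry the Frobenius norm `(∑ i j, (q i j) ^ 2) ^ (1 / 2)` and the metric it induces. -/
attribute [local instance] Matrix.frobeniusNormedAddCommGroup Matrix.frobeniusNormedSpace

namespace SignedDistance

/-- The degeneration locus `Σ` of singular `d × d` matrices. -/
def degenerationLocus (d : ℕ) : Set (Matrix (Fin d) (Fin d) ℝ) :=
  {q | q.det = 0}

/-- The signed distance `S q = sign (det q) * dist (q, Σ)`, for the Frobenius distance. -/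
noncomputable def signedDist (d : ℕ) (q : Matrix (Fin d) (Fin d) ℝ) : ℝ :=
  Real.sign q.det * Metric.infDist q (degenerationLocus d)

/-- The singular locus of the signed distance: the points at which it is not smooth. -/
def singularLocus (d : ℕ) : Set (Matrix (Fin d) (Fin d) ℝ) :=
  {q | ¬ ContDiffAt ℝ ∞ (signedDist d) q}

/-- The `i`-th principal (singular) value of `q`, in decreasing order, with the usual
indexing `i = 1, …, d` (Mathlib counts singular values from `0`). -/
noncomputable def principalValue {d : ℕ} (q : Matrix (Fin d) (Fin d) ℝ) (i : ℕ) : ℝ :=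
  (Matrix.toEuclideanLin q).singularValues (i - 1)

/-- `x` lists the signed singular values of `q`: one has `q = g₁ * diag x * g₂` with `g₁, g₂` in
`SO(d)` and `x₁ ≥ x₂ ≥ … ≥ x_{d-1} ≥ |x_d|`. The ordering is written as `|x j| ≤ x i` for all
`i < j`, which says the same since every entry but the last is then nonnegative. -/
def IsSignedSingularValues {d : ℕ} (q : Matrix (Fin d) (Fin d) ℝ) (x : Fin d → ℝ) : Prop :=
  (∀ i j : Fin d, i < j → |x j| ≤ x i) ∧
    ∃ g₁ ∈ Matrix.specialOrthogonalGroup (Fin d) ℝ,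
      ∃ g₂ ∈ Matrix.specialOrthogonalGroup (Fin d) ℝ, q = g₁ * Matrix.diagonal x * g₂

/-- Semialgebraic subsets of `ℝ^ι`: the smallest class of sets that contains every set `{p > 0}`,
`p` a real polynomial, and is closed under complements and finite unions. -/
inductive IsSemialgebraic {ι : Type} : Set (ι → ℝ) → Prop
  | pos (p : MvPolynomial ι ℝ) : IsSemialgebraic {v | 0 < MvPolynomial.eval v p}
  | compl {A : Set (ι → ℝ)} : IsSemialgebraic A → IsSemialgebraic Aᶜ
  | union {A B : Set (ι → ℝ)} : IsSemialgebraic A → IsSemialgebraic B → IsSemialgebraic (A ∪ B)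

/-- A set of matrices is semialgebraic if it is so in the matrix entries. -/
def IsSemialgebraicMatrixSet {d : ℕ} (A : Set (Matrix (Fin d) (Fin d) ℝ)) : Prop :=
  IsSemialgebraic {v : Fin d × Fin d → ℝ | Matrix.of (fun i j => v (i, j)) ∈ A}

/-- `A` has codimension `c` in the finite-dimensional space `E`. The dimension of `A` is taken to be
its Hausdorff dimension, which for a semialgebraic set is its dimension in every usual sense
(largest dimension of a cell or of a smooth submanifold contained in `A`). -/
def HasCodimension {E : Type*} [NormedAddCommGroup E] [NormedSpace ℝ E] (A : Set E) (c : ℕ) :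
    Prop :=
  dimH A + c = (Module.finrank ℝ E : ENNReal)

end SignedDistance

/-! Write q = U diag(x) V with U, V orthogonal. Deleting an entry of least absolute value gives a
nearest singular matrix, so dist(q, Σ) = min |x_i| (`infDist_degenerationLocus`), and smoothness
depends only on whether this minimum is attained once.

If it is attained once, λ = dist² is a simple root of the characteristic polynomial of qᵀq, hence
smooth in q by the implicit function theorem. The product of the other roots is, up to sign, a
polynomial in λ and the entries of q, and S is det q divided by the square root of its absolute
value (`signedDist_eq_div`); this is smooth across Σ as well. If the minimum is attained twice and
is nonzero, scaling one of the minimal entries shows a kink of S; if it is zero, such kinks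
accumulate at q (`mem_singularLocus_of_eq`).

Semialgebraicity needs no quantifier elimination. That an eigenvalue of qᵀq is smallest and simple
is a sign condition on the Taylor coefficients of the characteristic polynomial there. A sum over
the eigenvalues of signs of a polynomial is the signature of a symmetric matrix, and Descartes'
rule, exact for real-rooted polynomials, reads it off the signs of polynomials in the entries of q
(`sum_sign_eq_of_sign_coeff_eq`, `sum_sign_shiftProd_pos_iff`).

For the dimension, a rotation in the plane of the last two coordinates passes through a diagonal
matrix whose last two entries agree up to sign. So one of the d(d - 1) Euler angles of U and V is
redundant, which leaves d(d - 1) - 1 + (d - 1) = d² - 2 parameters. Conversely, exp(X - Xᵀ) diag(x)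
exp(Y - Yᵀ), projected to d² - 2 matrix entries, has a surjective derivative at a suitable point of
the locus. -/

namespace SignedDistance

/-! ### Singular value decomposition, orthogonal and special orthogonal -/

open Module InnerProductSpace

/-- The matrix whose columns are an orthonormal basis is orthogonal. -/
theorem orthonormalBasis_mem_orthogonalGroup {d : ℕ}
    (b : OrthonormalBasis (Fin d) ℝ (EuclideanSpace ℝ (Fin d))) :
    Matrix.of (fun i j => b i j) ∈ Matrix.orthogonalGroup (Fin d) ℝ := by
  rw [Matrix.mem_orthogonalGroup_iff]
  ext i j
  have h := orthonormal_iff_ite.1 b.orthonormal i j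
  rw [EuclideanSpace.inner_eq_star_dotProduct, dotProduct_comm] at h
  simpa [Matrix.mul_apply, dotProduct, Matrix.one_apply] using h

/-- An orthonormal eigenbasis v of TᵀT is mapped by T to orthogonal vectors of lengths σ i. The
nonzero ones, normalised, extend to an orthonormal basis b, and then T (v i) = σ i • b i for every
i. -/
theorem exists_singular_value_decomposition {d : ℕ} (q : Matrix (Fin d) (Fin d) ℝ) :
    ∃ U ∈ Matrix.orthogonalGroup (Fin d) ℝ, ∃ V ∈ Matrix.orthogonalGroup (Fin d) ℝ,
      q = U * Matrix.diagonal (fun i : Fin d => (Matrix.toEuclideanLin q).singularValues i) * V := by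
  set T := Matrix.toEuclideanLin q with hT
  have hn : finrank ℝ (EuclideanSpace ℝ (Fin d)) = d := by simp
  set v := T.isSymmetric_adjoint_comp_self.eigenvectorBasis hn
  set σ : Fin d → ℝ := fun i => T.singularValues i
  have hv : ∀ i j, ⟪T (v i), T (v j)⟫_ℝ = if i = j then σ i ^ 2 else 0 := by
    intro i j
    have h1 := T.isSymmetric_adjoint_comp_self.apply_eigenvectorBasis hn j
    rw [← T.sq_singularValues_fin hn j] at h1
    rw [← LinearMap.adjoint_inner_right]
    simp only [LinearMap.comp_apply] at h1
    rw [h1, inner_smul_right, orthonormal_iff_ite.1 v.orthonormal]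
    split_ifs with h <;> simp [h, σ]
  have horth : Orthonormal ℝ (({i | σ i ≠ 0} : Set (Fin d)).domRestrict
      fun i => (σ i)⁻¹ • T (v i)) := by
    rw [orthonormal_iff_ite]
    rintro ⟨i, hi⟩ ⟨j, hj⟩
    simp only [Set.mem_ofPred_eq] at hi hj
    simp only [Set.domRestrict_apply, inner_smul_left, inner_smul_right, hv, Subtype.mk.injEq]
    split_ifs with h
    · subst h
      simp
      field_simp
    · simp
  obtain ⟨b, hb⟩ := horth.exists_orthonormalBasis_extension_of_card_eq (by simp)
  have hTb : ∀ i, T (v i) = σ i • b i := by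
    intro i
    by_cases hi : σ i = 0
    · have := hv i i
      simp only [if_true, hi, ne_eq, OfNat.ofNat_ne_zero, not_false_eq_true, zero_pow,
        inner_self_eq_zero] at this
      simp [this, hi]
    · rw [hb i hi, smul_smul, mul_inv_cancel₀ hi, one_smul]
  have hV := orthonormalBasis_mem_orthogonalGroup v
  have hU := orthonormalBasis_mem_orthogonalGroup b
  set V : Matrix (Fin d) (Fin d) ℝ := Matrix.of (fun i j => v i j) with hVdef
  set U : Matrix (Fin d) (Fin d) ℝ := Matrix.of (fun i j => b i j) with hUdef
  refine ⟨Uᵀ, ?_, V, hV, ?_⟩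
  · rw [Matrix.mem_orthogonalGroup_iff']
    rw [Matrix.mem_orthogonalGroup_iff] at hU
    simpa [Matrix.star_eq_conjTranspose] using hU
  -- The basis vectors are the rows of U and V, so this is T (v j) = σ j • b j read entrywise.
  · have key : q * Vᵀ = Uᵀ * Matrix.diagonal σ := by
      ext i j
      have := congrArg (fun w => w i) (hTb j)
      simp only [hT, Matrix.toLpLin_apply, PiLp.smul_apply, smul_eq_mul] at this
      rw [Matrix.mul_diagonal]
      simp only [Matrix.mul_apply, Matrix.transpose_apply, hVdef, hUdef, Matrix.of_apply]
      rw [mul_comm, ← this]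
      rfl
    have hVV : Vᵀ * V = 1 := by
      have := (Matrix.mem_orthogonalGroup_iff' (Fin d) ℝ).1 hV
      simpa [Matrix.star_eq_conjTranspose] using this
    rw [← key, mul_assoc, hVV, mul_one]

/-- An orthogonal matrix becomes special orthogonal after multiplying one coordinate by its
determinant. -/
theorem exists_sign_diagonal {d : ℕ} (b : Fin d) {U : Matrix (Fin d) (Fin d) ℝ}
    (hU : U ∈ Matrix.orthogonalGroup (Fin d) ℝ) :
    ∃ s : ℝ, |s| = 1 ∧
      Matrix.diagonal (Function.update 1 b s) * Matrix.diagonal (Function.update 1 b s) =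
        (1 : Matrix (Fin d) (Fin d) ℝ) ∧
      U * Matrix.diagonal (Function.update 1 b s) ∈ Matrix.specialOrthogonalGroup (Fin d) ℝ ∧
      Matrix.diagonal (Function.update 1 b s) * U ∈ Matrix.specialOrthogonalGroup (Fin d) ℝ := by
  have hdet : U.det * U.det = 1 := by
    have := congrArg Matrix.det ((Matrix.mem_orthogonalGroup_iff (Fin d) ℝ).1 hU)
    simpa [Matrix.star_eq_conjTranspose] using this
  have hE : Matrix.diagonal (Function.update 1 b U.det) *
      Matrix.diagonal (Function.update 1 b U.det) = (1 : Matrix (Fin d) (Fin d) ℝ) := by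
    rw [Matrix.diagonal_mul_diagonal, ← Matrix.diagonal_one]
    congr 1
    ext i
    by_cases h : i = b
    · subst h; simpa using hdet
    · simp [h]
  have hEo : Matrix.diagonal (Function.update 1 b U.det) ∈ Matrix.orthogonalGroup (Fin d) ℝ := by
    rw [Matrix.mem_orthogonalGroup_iff]
    simpa [Matrix.star_eq_conjTranspose, Matrix.diagonal_conjTranspose] using hE
  have hEd : (Matrix.diagonal (Function.update 1 b U.det)).det = U.det := by
    rw [Matrix.det_diagonal, Finset.prod_update_of_mem (Finset.mem_univ b)]
    simp
  refine ⟨U.det, ?_, hE, ?_, ?_⟩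
  · rcases mul_self_eq_one_iff.1 hdet with h | h <;> simp [h]
  · exact Matrix.mem_specialOrthogonalGroup_iff.2 ⟨mul_mem hU hEo, by
      rw [Matrix.det_mul, hEd, hdet]⟩
  · exact Matrix.mem_specialOrthogonalGroup_iff.2 ⟨mul_mem hEo hU, by
      rw [Matrix.det_mul, hEd, hdet]⟩

/-- The determinants ±1 of U and V are moved into coordinate b. Since b is the last index, only the
last entry of x can become negative and the ordering survives. -/
theorem exists_isSignedSingularValues {d : ℕ} (b : Fin d) (hb : ∀ i, i ≤ b)
    (q : Matrix (Fin d) (Fin d) ℝ) :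
    ∃ x : Fin d → ℝ, IsSignedSingularValues q x ∧
      ∀ i, |x i| = (Matrix.toEuclideanLin q).singularValues i := by
  obtain ⟨U, hU, V, hV, hq⟩ := exists_singular_value_decomposition q
  set T := Matrix.toEuclideanLin q
  set σ : Fin d → ℝ := fun i => T.singularValues i with hσ
  obtain ⟨s, hs, hss, hsU, -⟩ := exists_sign_diagonal b hU
  obtain ⟨t, ht, htt, -, htV⟩ := exists_sign_diagonal b hV
  have habs : ∀ i, |Function.update (1 : Fin d → ℝ) b s i * σ i *
      Function.update (1 : Fin d → ℝ) b t i| = σ i := by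
    intro i
    have h0 : |σ i| = σ i := abs_of_nonneg (T.singularValues_nonneg i)
    by_cases h : i = b
    · subst h; simp [abs_mul, hs, ht, h0]
    · simp [h, h0]
  refine ⟨fun i => Function.update (1 : Fin d → ℝ) b s i * σ i *
      Function.update (1 : Fin d → ℝ) b t i,
    ⟨?_, _, hsU, _, htV, ?_⟩, habs⟩
  · intro i j hij
    rw [habs]
    have hib : i ≠ b := fun h => absurd (hb j) (by rw [← h]; exact not_le.2 hij)
    simpa [hib] using T.singularValues_antitone hij.le
  · rw [← Matrix.diagonal_mul_diagonal, ← Matrix.diagonal_mul_diagonal]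
    set E := Matrix.diagonal (Function.update (1 : Fin d → ℝ) b s)
    set F := Matrix.diagonal (Function.update (1 : Fin d → ℝ) b t)
    calc q = U * (E * E) * Matrix.diagonal σ * (F * F) * V := by rw [hss, htt, mul_one, mul_one, hq]
      _ = _ := by simp only [mul_assoc]

/-! ### Frobenius norm and distance to the degeneration locus -/

theorem frobenius_norm_sq {d : ℕ} (A : Matrix (Fin d) (Fin d) ℝ) :
    ‖A‖ ^ 2 = ∑ i, ∑ j, A i j ^ 2 := by
  rw [Matrix.frobenius_norm_def, ← Real.sqrt_eq_rpow, Real.sq_sqrt (by positivity)]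
  simp

theorem frobenius_norm_sq_eq_trace {d : ℕ} (A : Matrix (Fin d) (Fin d) ℝ) :
    ‖A‖ ^ 2 = (Aᵀ * A).trace := by
  rw [frobenius_norm_sq, Finset.sum_comm]
  simp [Matrix.trace, Matrix.mul_apply, sq]

theorem transpose_mul_self_of_mem {d : ℕ} {U : Matrix (Fin d) (Fin d) ℝ}
    (hU : U ∈ Matrix.orthogonalGroup (Fin d) ℝ) : Uᵀ * U = 1 := by
  simpa [Matrix.star_eq_conjTranspose] using (Matrix.mem_orthogonalGroup_iff' (Fin d) ℝ).1 hU

theorem mul_transpose_self_of_mem {d : ℕ} {U : Matrix (Fin d) (Fin d) ℝ}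
    (hU : U ∈ Matrix.orthogonalGroup (Fin d) ℝ) : U * Uᵀ = 1 := by
  simpa [Matrix.star_eq_conjTranspose] using (Matrix.mem_orthogonalGroup_iff (Fin d) ℝ).1 hU

theorem det_mul_self_of_mem {d : ℕ} {U : Matrix (Fin d) (Fin d) ℝ}
    (hU : U ∈ Matrix.orthogonalGroup (Fin d) ℝ) : U.det * U.det = 1 := by
  simpa using congrArg Matrix.det (mul_transpose_self_of_mem hU)

theorem transpose_mul_self_mul_diagonal_mul {d : ℕ} {U V : Matrix (Fin d) (Fin d) ℝ}
    (hU : U ∈ Matrix.orthogonalGroup (Fin d) ℝ) (x : Fin d → ℝ) :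
    (U * Matrix.diagonal x * V)ᵀ * (U * Matrix.diagonal x * V) =
      Vᵀ * Matrix.diagonal (fun i => x i ^ 2) * V := by
  have : Matrix.diagonal (fun i => x i ^ 2) = Matrix.diagonal x * Matrix.diagonal x := by
    rw [Matrix.diagonal_mul_diagonal]; simp [sq]
  rw [this]
  simp only [Matrix.transpose_mul, Matrix.diagonal_transpose]
  calc _ = Vᵀ * (Matrix.diagonal x * (Uᵀ * U) * Matrix.diagonal x) * V := by simp only [mul_assoc]
    _ = _ := by rw [transpose_mul_self_of_mem hU, mul_one]

theorem norm_mul_diagonal_mul {d : ℕ} {U V : Matrix (Fin d) (Fin d) ℝ}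
    (hU : U ∈ Matrix.orthogonalGroup (Fin d) ℝ) (hV : V ∈ Matrix.orthogonalGroup (Fin d) ℝ)
    (x : Fin d → ℝ) : ‖U * Matrix.diagonal x * V‖ ^ 2 = ∑ i, x i ^ 2 := by
  rw [frobenius_norm_sq_eq_trace, transpose_mul_self_mul_diagonal_mul hU, Matrix.trace_mul_comm,
    ← mul_assoc, mul_transpose_self_of_mem hV, one_mul, Matrix.trace_diagonal]

theorem sum_mulVec_sq_le {d : ℕ} (A : Matrix (Fin d) (Fin d) ℝ) (v : Fin d → ℝ) :
    ∑ i, (A *ᵥ v) i ^ 2 ≤ ‖A‖ ^ 2 * ∑ i, v i ^ 2 := by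
  rw [frobenius_norm_sq, Finset.sum_mul]
  exact Finset.sum_le_sum fun i _ => Finset.sum_mul_sq_le_sq_mul_sq Finset.univ (A i) v

theorem sum_mulVec_sq {d : ℕ} (A : Matrix (Fin d) (Fin d) ℝ) (v : Fin d → ℝ) :
    ∑ i, (A *ᵥ v) i ^ 2 = v ⬝ᵥ ((Aᵀ * A) *ᵥ v) := by
  rw [← Matrix.mulVec_mulVec, Matrix.dotProduct_mulVec, Matrix.vecMul_transpose]
  simp [dotProduct, sq]

/-- Replacing x b by 0 gives a singular matrix at distance |x b|. Conversely, if m is singular with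
kernel vector v, then ‖q - m‖ |v| ≥ |(q - m) v| = |q v| ≥ |x b| |v|. -/
theorem infDist_degenerationLocus {d : ℕ} {U V : Matrix (Fin d) (Fin d) ℝ}
    (hU : U ∈ Matrix.orthogonalGroup (Fin d) ℝ) (hV : V ∈ Matrix.orthogonalGroup (Fin d) ℝ)
    (x : Fin d → ℝ) (b : Fin d) (hb : ∀ i, |x b| ≤ |x i|) :
    Metric.infDist (U * Matrix.diagonal x * V) (degenerationLocus d) = |x b| := by
  have hm : U * Matrix.diagonal (Function.update x b 0) * V ∈ degenerationLocus d := by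
    simp only [degenerationLocus, Set.mem_ofPred_eq, Matrix.det_mul, Matrix.det_diagonal]
    rw [Finset.prod_eq_zero (Finset.mem_univ b) (by simp)]
    simp
  apply le_antisymm
  · refine (Metric.infDist_le_dist_of_mem hm).trans ?_
    rw [dist_eq_norm, ← sub_mul, ← mul_sub, Matrix.diagonal_sub]
    refine abs_le_of_sq_le_sq' ?_ (abs_nonneg _) |>.2
    rw [norm_mul_diagonal_mul hU hV, Finset.sum_eq_single b]
    · simp
    · intro i _ hi; simp [hi]
    · simp
  · refine (Metric.le_infDist ⟨_, hm⟩).2 fun {m} hmem => ?_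
    obtain ⟨v, hv0, hv⟩ := Matrix.exists_mulVec_eq_zero_iff.2 hmem
    have hpos : 0 < ∑ i, v i ^ 2 := by
      obtain ⟨i, hi⟩ := Function.ne_iff.1 hv0
      exact Finset.sum_pos' (fun i _ => sq_nonneg _) ⟨i, Finset.mem_univ _, sq_pos_of_ne_zero hi⟩
    have h1 := sum_mulVec_sq_le (U * Matrix.diagonal x * V - m) v
    rw [Matrix.sub_mulVec, hv, sub_zero, sum_mulVec_sq, transpose_mul_self_mul_diagonal_mul hU,
      ← Matrix.mulVec_mulVec, ← Matrix.mulVec_mulVec, Matrix.dotProduct_mulVec,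
      Matrix.vecMul_transpose] at h1
    have h2 : ∑ i, (V *ᵥ v) i ^ 2 = ∑ i, v i ^ 2 := by
      rw [sum_mulVec_sq, transpose_mul_self_of_mem hV, Matrix.one_mulVec]
      simp [dotProduct, sq]
    have h3 : |x b| ^ 2 * ∑ i, v i ^ 2 ≤
        (V *ᵥ v) ⬝ᵥ (Matrix.diagonal (fun i => x i ^ 2) *ᵥ (V *ᵥ v)) := by
      rw [← h2, Finset.mul_sum]
      refine Finset.sum_le_sum fun i _ => ?_
      rw [Matrix.mulVec_diagonal]
      have : |x b| ^ 2 ≤ x i ^ 2 := by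
        rw [← sq_abs (x i)]; exact pow_le_pow_left₀ (abs_nonneg _) (hb i) 2
      nlinarith [sq_nonneg ((V *ᵥ v) i)]
    rw [dist_eq_norm]
    exact (abs_le_of_sq_le_sq' (le_of_mul_le_mul_right (h3.trans h1) hpos) (norm_nonneg _)).2

/-! ### Failure of smoothness at a repeated minimum -/

theorem real_sign_mul_of_pos (a : ℝ) {t : ℝ} (ht : 0 < t) : Real.sign (a * t) = Real.sign a := by
  rcases lt_trichotomy a 0 with h | h | h
  · rw [Real.sign_of_neg h, Real.sign_of_neg (mul_neg_of_neg_of_pos h ht)]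
  · simp [h]
  · rw [Real.sign_of_pos h, Real.sign_of_pos (mul_pos h ht)]

theorem signedDist_mul_diagonal_mul {d : ℕ} {U V : Matrix (Fin d) (Fin d) ℝ}
    (hU : U ∈ Matrix.orthogonalGroup (Fin d) ℝ) (hV : V ∈ Matrix.orthogonalGroup (Fin d) ℝ)
    (x : Fin d → ℝ) (b : Fin d) (hb : ∀ i, |x b| ≤ |x i|) :
    signedDist d (U * Matrix.diagonal x * V) =
      Real.sign (U.det * (∏ i, x i) * V.det) * |x b| := by
  rw [signedDist, infDist_degenerationLocus hU hV x b hb, Matrix.det_mul, Matrix.det_mul,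
    Matrix.det_diagonal]

/-- Along the line that scales x j by 1 + t the determinant keeps its sign near t = 0, while the
minimum is |x j| (1 + t) for t ≤ 0 and stays at |x b| for t ≥ 0. This is a kink. -/
theorem not_differentiableAt_signedDist {d : ℕ} {U V : Matrix (Fin d) (Fin d) ℝ}
    (hU : U ∈ Matrix.orthogonalGroup (Fin d) ℝ) (hV : V ∈ Matrix.orthogonalGroup (Fin d) ℝ)
    (x : Fin d → ℝ) {b j : Fin d} (hb : ∀ i, |x b| ≤ |x i|) (hjb : j ≠ b) (hj : |x j| = |x b|)
    (h0 : x b ≠ 0) : ¬ DifferentiableAt ℝ (signedDist d) (U * Matrix.diagonal x * V) := by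
  intro hdiff
  set c := |x b| with hc
  have hc0 : 0 < c := abs_pos.2 h0
  set s := Real.sign (U.det * (∏ i, x i) * V.det) with hs
  have hs0 : s ≠ 0 := by
    rw [hs, Ne, Real.sign_eq_zero_iff]
    refine mul_ne_zero (mul_ne_zero ?_ ?_) ?_
    · exact left_ne_zero_of_mul_eq_one (det_mul_self_of_mem hU)
    · refine Finset.prod_ne_zero_iff.2 fun i _ => abs_pos.1 (hc0.trans_le (hb i))
    · exact left_ne_zero_of_mul_eq_one (det_mul_self_of_mem hV)
  set y : ℝ → Fin d → ℝ := fun t => Function.update x j (x j * (1 + t)) with hy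
  have hyj : ∀ t, y t j = x j * (1 + t) := fun t => by simp [hy]
  have hyi : ∀ t i, i ≠ j → y t i = x i := fun t i hi => by simp [hy, hi]
  have hdy : Differentiable ℝ fun t => U * Matrix.diagonal (y t) * V := by
    have : (fun t => U * Matrix.diagonal (y t) * V) = fun t : ℝ =>
        U * Matrix.diagonal x * V + t • (U * Matrix.diagonal (Pi.single j (x j)) * V) := by
      ext1 t
      rw [← smul_mul_assoc, ← mul_smul_comm, ← add_mul, ← mul_add, ← Matrix.diagonal_smul,
        Matrix.diagonal_add]
      congr 3
      ext i
      by_cases hi : i = j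
      · subst hi; simp [hy]; ring
      · simp [hy, hi]
    rw [this]
    fun_prop
  have hy0 : y 0 = x := by ext i; by_cases hi : i = j <;> simp [hy, hi]
  have hcomp : DifferentiableAt ℝ (fun t => signedDist d (U * Matrix.diagonal (y t) * V)) 0 := by
    refine DifferentiableAt.comp (0 : ℝ) (g := signedDist d) ?_ hdy.differentiableAt
    rw [hy0]; exact hdiff
  -- The term (t - |t|) / 2 is min(t, 0); solving for |t| below contradicts its
  -- non-differentiability at 0.
  have hval : ∀ᶠ t in nhds (0 : ℝ), signedDist d (U * Matrix.diagonal (y t) * V) =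
      s * (c * (1 + (t - |t|) / 2)) := by
    filter_upwards [Ioo_mem_nhds (show (-1 : ℝ) < 0 by norm_num) (show (0 : ℝ) < 1 by norm_num)]
      with t ht
    have ht1 : 0 < 1 + t := by linarith [ht.1]
    have hprod : ∏ i, y t i = (∏ i, x i) * (1 + t) := by
      rw [hy, Finset.prod_update_of_mem (Finset.mem_univ j),
        ← Finset.mul_prod_erase _ x (Finset.mem_univ j), Finset.sdiff_singleton_eq_erase]
      ring
    have hsign : Real.sign (U.det * (∏ i, y t i) * V.det) = s := by
      rw [hprod, hs]
      have : U.det * ((∏ i, x i) * (1 + t)) * V.det = (U.det * (∏ i, x i) * V.det) * (1 + t) := by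
        ring
      rw [this, real_sign_mul_of_pos _ ht1]
    have habsj : |y t j| = c * (1 + t) := by rw [hyj, abs_mul, hj, abs_of_pos ht1]
    rcases le_total 0 t with h | h
    · rw [signedDist_mul_diagonal_mul hU hV (y t) b, hsign, hyi t b hjb.symm, abs_of_nonneg h]
      · simp [hc]
      · intro i
        rw [hyi t b hjb.symm]
        by_cases hi : i = j
        · rw [hi, habsj]; nlinarith
        · rw [hyi t i hi]; exact hb i
    · rw [signedDist_mul_diagonal_mul hU hV (y t) j, hsign, habsj, abs_of_nonpos h]
      · ring
      · intro i
        by_cases hi : i = j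
        · rw [hi]
        · rw [habsj, hyi t i hi]; exact le_trans (by nlinarith) (hb i)
  have habs : DifferentiableAt ℝ (fun t : ℝ => t - 2 * (
      signedDist d (U * Matrix.diagonal (y t) * V) / (s * c) - 1)) 0 := by fun_prop
  refine not_differentiableAt_abs_zero (habs.congr_of_eventuallyEq ?_)
  filter_upwards [hval] with t ht
  rw [ht]
  field_simp
  ring

/-- For x b ≠ 0 differentiability already fails at the point itself. For x b = 0, smoothness would
give differentiability on a neighbourhood, and this contains points with a repeated nonzero minimum.
-/
theorem mem_singularLocus_of_eq {d : ℕ} {U V : Matrix (Fin d) (Fin d) ℝ}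
    (hU : U ∈ Matrix.orthogonalGroup (Fin d) ℝ) (hV : V ∈ Matrix.orthogonalGroup (Fin d) ℝ)
    (x : Fin d → ℝ) {b j : Fin d} (hb : ∀ i, |x b| ≤ |x i|) (hjb : j ≠ b) (hj : |x j| = |x b|) :
    U * Matrix.diagonal x * V ∈ singularLocus d := by
  intro hsm
  by_cases h0 : x b = 0
  · have hev : ∀ᶠ q in nhds (U * Matrix.diagonal x * V), DifferentiableAt ℝ (signedDist d) q := by
      have h1 : ContDiffAt ℝ 1 (signedDist d) (U * Matrix.diagonal x * V) :=
        hsm.of_le (by exact_mod_cast le_top)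
      filter_upwards [h1.eventually (by simp)] with q hq using hq.differentiableAt (by simp)
    -- All zero entries move to t, so for small t > 0 both b and j attain the minimum t.
    set y : ℝ → Fin d → ℝ := fun t i => if x i = 0 then t else x i with hy
    have hcont : Continuous fun t => U * Matrix.diagonal (y t) * V := by
      have : Continuous y := continuous_pi fun i => by
        by_cases hi : x i = 0 <;> simp [hy, hi, continuous_id', continuous_const]
      fun_prop
    have hy0 : y 0 = x := by ext i; by_cases hi : x i = 0 <;> simp [hy, hi]
    have hj0 : x j = 0 := by simpa [h0] using hj
    have h1 : ∀ᶠ t in nhdsWithin (0 : ℝ) (Set.Ioi 0),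
        DifferentiableAt ℝ (signedDist d) (U * Matrix.diagonal (y t) * V) := by
      refine nhdsWithin_le_nhds (hcont.continuousAt.eventually ?_)
      simpa only [hy0] using hev
    have h2 : ∀ i, ∀ᶠ t in nhdsWithin (0 : ℝ) (Set.Ioi 0), t ≤ |y t i| := by
      intro i
      by_cases hi : x i = 0
      · exact Filter.Eventually.of_forall fun t => by simp [hy, hi, le_abs_self]
      · filter_upwards [nhdsWithin_le_nhds (Iic_mem_nhds (abs_pos.2 hi))] with t ht
        simpa [hy, hi] using ht
    obtain ⟨t, ht1, ht2, ht0⟩ :=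
      (h1.and ((Filter.eventually_all.2 h2).and self_mem_nhdsWithin)).exists
    have hyb : y t b = t := by simp [hy, h0]
    have hyj : y t j = t := by simp [hy, hj0]
    refine not_differentiableAt_signedDist hU hV (y t) (b := b) (j := j) ?_ hjb ?_ ?_ ht1
    · intro i; rw [hyb, abs_of_pos ht0]; exact ht2 i
    · rw [hyb, hyj]
    · rw [hyb]; exact ne_of_gt ht0
  · exact not_differentiableAt_signedDist hU hV x hb hjb hj h0 (hsm.differentiableAt (by simp))

/-! ### Smoothness at a simple smallest singular value -/

open Polynomial in
theorem charpoly_transpose_mul_mul {d : ℕ} {V : Matrix (Fin d) (Fin d) ℝ}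
    (hV : V ∈ Matrix.orthogonalGroup (Fin d) ℝ) (x : Fin d → ℝ) :
    (Vᵀ * Matrix.diagonal x * V).charpoly = ∏ i, (X - C (x i)) := by
  rw [Matrix.charpoly_mul_comm, ← mul_assoc, mul_transpose_self_of_mem hV, one_mul,
    Matrix.charpoly_diagonal]

open Polynomial in
theorem charpoly_gram {d : ℕ} {U V : Matrix (Fin d) (Fin d) ℝ}
    (hU : U ∈ Matrix.orthogonalGroup (Fin d) ℝ) (hV : V ∈ Matrix.orthogonalGroup (Fin d) ℝ)
    (x : Fin d → ℝ) :
    ((U * Matrix.diagonal x * V)ᵀ * (U * Matrix.diagonal x * V)).charpoly =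
      ∏ i, (X - C (x i ^ 2)) := by
  rw [transpose_mul_self_mul_diagonal_mul hU, charpoly_transpose_mul_mul hV]

/-- The matrix `qᵀ * q` for the matrix `q` of indeterminates. -/
noncomputable def genericGram (d : ℕ) :
    Matrix (Fin d) (Fin d) (MvPolynomial (Fin d × Fin d) ℝ) :=
  (Matrix.mvPolynomialX (Fin d) (Fin d) ℝ)ᵀ * Matrix.mvPolynomialX (Fin d) (Fin d) ℝ

/-- Evaluation of polynomials in the matrix entries. -/
noncomputable abbrev evalAt {d : ℕ} (q : Matrix (Fin d) (Fin d) ℝ) :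
    MvPolynomial (Fin d × Fin d) ℝ →+* ℝ :=
  MvPolynomial.eval fun p => q p.1 p.2

theorem genericGram_map {d : ℕ} (q : Matrix (Fin d) (Fin d) ℝ) :
    (genericGram d).map (evalAt q) = qᵀ * q := by
  have h := Matrix.mvPolynomialX_mapMatrix_eval q
  rw [RingHom.mapMatrix_apply] at h
  rw [genericGram, Matrix.map_mul, Matrix.transpose_map, h]

theorem charpoly_genericGram_map {d : ℕ} (q : Matrix (Fin d) (Fin d) ℝ) :
    (genericGram d).charpoly.map (evalAt q) = (qᵀ * q).charpoly := by
  rw [← Matrix.charpoly_map, genericGram_map]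

theorem contDiff_evalAt {d : ℕ} (P : MvPolynomial (Fin d × Fin d) ℝ) :
    ContDiff ℝ ∞ fun q : Matrix (Fin d) (Fin d) ℝ => evalAt q P := by
  induction P using MvPolynomial.induction_on with
  | C a => simpa using contDiff_const
  | add P Q hP hQ => simpa using hP.add hQ
  | mul_X P n hP =>
    have h : ContDiff ℝ ∞ fun q : Matrix (Fin d) (Fin d) ℝ => q n.1 n.2 :=
      (LinearMap.toContinuousLinearMap (Matrix.entryLinearMap ℝ ℝ n.1 n.2)).contDiff
    simpa using hP.mul h

open Polynomial in
theorem contDiff_eval_map {d : ℕ} (P : (MvPolynomial (Fin d × Fin d) ℝ)[X]) :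
    ContDiff ℝ ∞ fun z : Matrix (Fin d) (Fin d) ℝ × ℝ => (P.map (evalAt z.1)).eval z.2 := by
  simp only [eval_map, eval₂_eq_sum_range]
  exact ContDiff.sum fun k _ =>
    ((contDiff_evalAt _).comp contDiff_fst).mul (contDiff_snd.pow k)

open Polynomial in
theorem contDiff_eval_charpoly_gram (d : ℕ) :
    ContDiff ℝ ∞ fun z : Matrix (Fin d) (Fin d) ℝ × ℝ => ((z.1ᵀ * z.1).charpoly).eval z.2 := by
  simpa only [charpoly_genericGram_map] using contDiff_eval_map (genericGram d).charpoly

open Polynomial in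
theorem contDiff_eval_divX_charpoly_gram (d : ℕ) :
    ContDiff ℝ ∞ fun z : Matrix (Fin d) (Fin d) ℝ × ℝ =>
      (((z.1ᵀ * z.1).charpoly).divX).eval z.2 := by
  have h (q : Matrix (Fin d) (Fin d) ℝ) :
      (genericGram d).charpoly.divX.map (evalAt q) = (qᵀ * q).charpoly.divX := by
    rw [← charpoly_genericGram_map]; ext; simp [coeff_divX]
  simpa only [h] using contDiff_eval_map (genericGram d).charpoly.divX

theorem contDiff_det (d : ℕ) :
    ContDiff ℝ ∞ fun q : Matrix (Fin d) (Fin d) ℝ => q.det := by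
  have h (q : Matrix (Fin d) (Fin d) ℝ) :
      evalAt q (Matrix.mvPolynomialX (Fin d) (Fin d) ℝ).det = q.det := by
    rw [RingHom.map_det, Matrix.mvPolynomialX_mapMatrix_eval]
  simpa only [h] using contDiff_evalAt (Matrix.mvPolynomialX (Fin d) (Fin d) ℝ).det

-- For P = (X - a) g the value is (P(a) - P(0)) / a when a ≠ 0. Using `divX` recovers g(0), up to
-- sign the product of the other roots, without dividing by a, so the formula persists at a = 0.
open Polynomial in
theorem eval_divX_X_sub_C_mul (a : ℝ) (g : ℝ[X]) :
    ((X - C a) * g).divX.eval a = g.eval 0 := by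
  have h1 : ((X - C a) * g).divX = g - C a * g.divX := by
    ext n
    simp [coeff_divX, sub_mul, coeff_X_mul]
  have h2 := congrArg (eval a) (divX_mul_X_add g)
  simp only [eval_add, eval_mul, eval_X, eval_C, coeff_zero_eq_eval_zero] at h2
  rw [h1, eval_sub, eval_mul, eval_C]
  linarith

open Polynomial in
theorem eval_derivative_X_sub_C_mul (a : ℝ) (g : ℝ[X]) :
    (derivative ((X - C a) * g)).eval a = g.eval a := by
  simp [derivative_mul]

/-- A zero of a smooth function that is simple in the last variable depends smoothly on the
other variables. -/
theorem contDiffAt_of_simple_zero {E : Type*} [NormedAddCommGroup E] [NormedSpace ℝ E]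
    [CompleteSpace E] {F : E × ℝ → ℝ} {l : E → ℝ} {q : E} {a : ℝ}
    (hF : ContDiff ℝ ∞ F) (hl : ContinuousAt l q) (h0 : ∀ p, F (p, l p) = 0)
    (ha : HasDerivAt (fun t => F (q, t)) a (l q)) (ha0 : a ≠ 0) :
    ContDiffAt ℝ ∞ l q := by
  have hF' : ContDiffAt ℝ ∞ F (q, l q) := hF.contDiffAt
  have hne : (∞ : WithTop ℕ∞) ≠ 0 := by simp
  have hinv : (fderiv ℝ F (q, l q) ∘L .inr ℝ E ℝ).IsInvertible := by
    have h1 : HasFDerivAt (fun t => F (q, t)) (fderiv ℝ F (q, l q) ∘L .inr ℝ E ℝ) (l q) :=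
      HasFDerivAt.comp (l q) (g := F) (hF'.differentiableAt hne).hasFDerivAt
        (hasFDerivAt_prodMk_right q (l q))
    refine ⟨ContinuousLinearEquiv.smulLeft (Units.mk0 a ha0), ?_⟩
    rw [h1.unique ha.hasFDerivAt]
    ext
    simp [Units.smul_def]
  refine (hF'.contDiffAt_implicitFunction hne hinv).congr_of_eventuallyEq ?_
  have h2 := hF'.eventually_apply_eq_iff_implicitFunction hne hinv
  have h3 : Filter.Tendsto (fun p => (p, l p)) (nhds q) (nhds (q, l q)) :=
    continuousAt_id.prodMk hl
  filter_upwards [h3.eventually h2] with p hp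
  exact (hp.1 (by rw [h0, h0])).symm

theorem exists_diagonal_decomposition {d : ℕ} (hd : 0 < d) (q : Matrix (Fin d) (Fin d) ℝ) :
    ∃ U ∈ Matrix.orthogonalGroup (Fin d) ℝ, ∃ V ∈ Matrix.orthogonalGroup (Fin d) ℝ,
      ∃ (x : Fin d → ℝ) (b : Fin d), (∀ i, |x b| ≤ |x i|) ∧ q = U * Matrix.diagonal x * V := by
  obtain ⟨U, hU, V, hV, hq⟩ := exists_singular_value_decomposition q
  have : Nonempty (Fin d) := ⟨⟨0, hd⟩⟩
  obtain ⟨b, hb⟩ := Finite.exists_min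
    fun i : Fin d => |(Matrix.toEuclideanLin q).singularValues i|
  exact ⟨U, hU, V, hV, _, b, hb, hq⟩

open Polynomial in
theorem prod_X_sub_C_eq_mul {d : ℕ} (a : Fin d → ℝ) (b : Fin d) :
    ∏ i, (X - C (a i)) = (X - C (a b)) * ∏ i ∈ Finset.univ.erase b, (X - C (a i)) :=
  (Finset.mul_prod_erase _ _ (Finset.mem_univ b)).symm

/-- The square of the distance to the degeneration locus: the smallest eigenvalue of `qᵀ * q`. -/
noncomputable def sqDist (d : ℕ) (q : Matrix (Fin d) (Fin d) ℝ) : ℝ :=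
  Metric.infDist q (degenerationLocus d) ^ 2

theorem continuous_sqDist (d : ℕ) : Continuous (sqDist d) :=
  (Metric.continuous_infDist_pt _).pow 2

theorem sqDist_mul_diagonal_mul {d : ℕ} {U V : Matrix (Fin d) (Fin d) ℝ}
    (hU : U ∈ Matrix.orthogonalGroup (Fin d) ℝ) (hV : V ∈ Matrix.orthogonalGroup (Fin d) ℝ)
    (x : Fin d → ℝ) (b : Fin d) (hb : ∀ i, |x b| ≤ |x i|) :
    sqDist d (U * Matrix.diagonal x * V) = x b ^ 2 := by
  rw [sqDist, infDist_degenerationLocus hU hV x b hb, sq_abs]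

theorem eval_charpoly_gram_sqDist {d : ℕ} (hd : 0 < d) (q : Matrix (Fin d) (Fin d) ℝ) :
    (qᵀ * q).charpoly.eval (sqDist d q) = 0 := by
  obtain ⟨U, hU, V, hV, x, b, hb, rfl⟩ := exists_diagonal_decomposition hd q
  rw [sqDist_mul_diagonal_mul hU hV x b hb, charpoly_gram hU hV,
    prod_X_sub_C_eq_mul (fun i => x i ^ 2) b]
  simp

open Polynomial in
theorem eval_divX_charpoly_gram_sqDist {d : ℕ} {U V : Matrix (Fin d) (Fin d) ℝ}
    (hU : U ∈ Matrix.orthogonalGroup (Fin d) ℝ) (hV : V ∈ Matrix.orthogonalGroup (Fin d) ℝ)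
    (x : Fin d → ℝ) (b : Fin d) (hb : ∀ i, |x b| ≤ |x i|) :
    |((U * Matrix.diagonal x * V)ᵀ * (U * Matrix.diagonal x * V)).charpoly.divX.eval
      (sqDist d (U * Matrix.diagonal x * V))| = (∏ i ∈ Finset.univ.erase b, |x i|) ^ 2 := by
  rw [sqDist_mul_diagonal_mul hU hV x b hb, charpoly_gram hU hV,
    prod_X_sub_C_eq_mul (fun i => x i ^ 2) b, eval_divX_X_sub_C_mul, eval_prod, Finset.abs_prod,
    ← Finset.prod_pow]
  simp

theorem real_sign_mul_abs (a : ℝ) : Real.sign a * |a| = a := by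
  rcases lt_trichotomy a 0 with h | h | h
  · rw [Real.sign_of_neg h, abs_of_neg h]; ring
  · simp [h]
  · rw [Real.sign_of_pos h, abs_of_pos h]; ring

theorem abs_det_of_mem {d : ℕ} {U : Matrix (Fin d) (Fin d) ℝ}
    (hU : U ∈ Matrix.orthogonalGroup (Fin d) ℝ) : |U.det| = 1 := by
  rcases mul_self_eq_one_iff.1 (det_mul_self_of_mem hU) with h | h <;> simp [h]

/-- Here |det q| = |x b| ∏_{i ≠ b} |x i|, and the absolute value under the root is the square of the
second factor. The sign of S comes from det q itself, so no sign function remains. -/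
theorem signedDist_eq_div {d : ℕ} (hd : 0 < d) (q : Matrix (Fin d) (Fin d) ℝ)
    (hq : (qᵀ * q).charpoly.divX.eval (sqDist d q) ≠ 0) :
    signedDist d q = q.det / √|(qᵀ * q).charpoly.divX.eval (sqDist d q)| := by
  rw [← abs_pos] at hq
  obtain ⟨U, hU, V, hV, x, b, hb, rfl⟩ := exists_diagonal_decomposition hd q
  rw [eval_divX_charpoly_gram_sqDist hU hV x b hb] at hq ⊢
  have h0 : 0 ≤ ∏ i ∈ Finset.univ.erase b, |x i| := Finset.prod_nonneg fun i _ => abs_nonneg _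
  have h1 : 0 < ∏ i ∈ Finset.univ.erase b, |x i| := h0.lt_of_ne fun h => by simp [← h] at hq
  rw [Real.sqrt_sq h0, eq_div_iff h1.ne', signedDist, infDist_degenerationLocus hU hV x b hb,
    mul_assoc, Finset.mul_prod_erase _ (fun i => |x i|) (Finset.mem_univ b)]
  conv_rhs => rw [← real_sign_mul_abs (Matrix.det _)]
  congr 1
  rw [Matrix.det_mul, Matrix.det_mul, abs_mul, abs_mul, abs_det_of_mem hU, abs_det_of_mem hV,
    Matrix.det_diagonal, Finset.abs_prod]
  ring

/-- The strict minimum makes x b ^ 2 a simple root, so `sqDist` is smooth at q. The other entries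
are nonzero even when x b = 0, so the denominator in `signedDist_eq_div` does not vanish near q. -/
theorem contDiffAt_signedDist_of_lt {d : ℕ} {U V : Matrix (Fin d) (Fin d) ℝ}
    (hU : U ∈ Matrix.orthogonalGroup (Fin d) ℝ) (hV : V ∈ Matrix.orthogonalGroup (Fin d) ℝ)
    (x : Fin d → ℝ) {b : Fin d} (hb : ∀ i, i ≠ b → |x b| < |x i|) :
    ContDiffAt ℝ ∞ (signedDist d) (U * Matrix.diagonal x * V) := by
  have hd : 0 < d := b.pos
  have hb' : ∀ i, |x b| ≤ |x i| := fun i => by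
    by_cases h : i = b
    · rw [h]
    · exact (hb i h).le
  have hval := eval_divX_charpoly_gram_sqDist hU hV x b hb'
  have hsq := sqDist_mul_diagonal_mul hU hV x b hb'
  have hch := charpoly_gram hU hV x
  set q := U * Matrix.diagonal x * V
  have hl : ContDiffAt ℝ ∞ (sqDist d) q := by
    refine contDiffAt_of_simple_zero (contDiff_eval_charpoly_gram d)
      (continuous_sqDist d).continuousAt (eval_charpoly_gram_sqDist hd)
      (Polynomial.hasDerivAt (qᵀ * q).charpoly _) ?_
    rw [hch, hsq, prod_X_sub_C_eq_mul (fun i => x i ^ 2) b, eval_derivative_X_sub_C_mul,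
      Polynomial.eval_prod]
    refine Finset.prod_ne_zero_iff.2 fun i hi => ?_
    have := sq_lt_sq.2 (hb i (Finset.ne_of_mem_erase hi))
    simp only [Polynomial.eval_sub, Polynomial.eval_X, Polynomial.eval_C]
    exact (sub_neg.2 this).ne
  have hD : ContDiffAt ℝ ∞ (fun p => (pᵀ * p).charpoly.divX.eval (sqDist d p)) q :=
    (contDiff_eval_divX_charpoly_gram d).contDiffAt.comp q (contDiffAt_id.prodMk hl)
  have hD0 : (qᵀ * q).charpoly.divX.eval (sqDist d q) ≠ 0 := by
    rw [← abs_pos, hval]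
    exact pow_pos (Finset.prod_pos fun i hi =>
      (abs_nonneg _).trans_lt (hb i (Finset.ne_of_mem_erase hi))) 2
  have hsmooth : ContDiffAt ℝ ∞
      (fun p => p.det / √|(pᵀ * p).charpoly.divX.eval (sqDist d p)|) q :=
    (contDiff_det d).contDiffAt.div ((hD.abs hD0).sqrt (abs_ne_zero.2 hD0))
      (Real.sqrt_ne_zero'.2 (abs_pos.2 hD0))
  refine hsmooth.congr_of_eventuallyEq ?_
  filter_upwards [hD.continuousAt.eventually_ne hD0] with p hp
  exact signedDist_eq_div hd p hp

/-! ### Descartes' rule for real-rooted polynomials and signatures -/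

open Polynomial in
theorem coeff_comp_neg_X' (P : ℝ[X]) (k : ℕ) : (P.comp (-X)).coeff k = (-1) ^ k * P.coeff k := by
  have h : (-X : ℝ[X]) = C (-1) * X := by simp
  rw [h, comp_C_mul_X_coeff]
  ring

open Polynomial in
theorem eraseLead_comp_neg_X (P : ℝ[X]) :
    (P.comp (-X)).eraseLead = P.eraseLead.comp (-X) := by
  ext k
  have h : (P.comp (-X)).natDegree = P.natDegree := by
    simp [natDegree_comp]
  rw [coeff_comp_neg_X', eraseLead_coeff, eraseLead_coeff, h, coeff_comp_neg_X']
  split_ifs <;> simp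

open Polynomial in
/-- The sign variations of `P(X)` and `P(-X)` together number at most the degree minus the order
of vanishing at `0`. -/
theorem signVariations_add_signVariations_comp_neg_le (n : ℕ) :
    ∀ (P : ℝ[X]) (z : ℕ), P ≠ 0 → P.natDegree = n → (∀ k < z, P.coeff k = 0) →
      P.signVariations + (P.comp (-X)).signVariations + z ≤ P.natDegree := by
  induction n using Nat.strong_induction_on with
  | _ n ih =>
    intro P z hP hn hz
    have hN : P.comp (-X) ≠ 0 := by rwa [Ne, comp_neg_X_eq_zero_iff]
    rw [signVariations_eq_eraseLead_add_ite hP, signVariations_eq_eraseLead_add_ite hN,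
      eraseLead_comp_neg_X]
    by_cases hE : P.eraseLead = 0
    · have hzn : z ≤ P.natDegree := by
        by_contra! h
        exact hP (leadingCoeff_eq_zero.1 (hz _ h))
      simp [hE, hP, hzn]
    · have hlt : P.eraseLead.natDegree < P.natDegree :=
        (eraseLead_natDegree_lt_or_eraseLead_eq_zero P).resolve_right hE
      have hE0 : ∀ k < z, P.eraseLead.coeff k = 0 := fun k hk => by
        rw [eraseLead_coeff]; split_ifs <;> simp [hz k hk]
      have hrec := ih _ (hn ▸ hlt) P.eraseLead z hE rfl hE0
      set a := P.leadingCoeff with ha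
      set c := P.eraseLead.leadingCoeff with hc
      have ha0 : a ≠ 0 := leadingCoeff_ne_zero.2 hP
      have hc0 : c ≠ 0 := leadingCoeff_ne_zero.2 hE
      rw [comp_neg_X_leadingCoeff_eq, comp_neg_X_leadingCoeff_eq, ← ha, ← hc]
      -- If the two leading exponents differ by one, their parities differ, so the leading sign
      -- change occurs in only one of P(X) and P(-X). A larger gap leaves room in the degree for
      -- both.
      by_cases hstep : P.natDegree = P.eraseLead.natDegree + 1
      · rw [hstep, pow_succ]
        have : ¬ (SignType.sign a = -SignType.sign c ∧
            SignType.sign ((-1) ^ P.eraseLead.natDegree * -1 * a) =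
              -SignType.sign ((-1) ^ P.eraseLead.natDegree * c)) := by
          rcases neg_one_pow_eq_or ℝ P.eraseLead.natDegree with h | h <;> rw [h] <;>
            rcases ha0.lt_or_gt with h1 | h1 <;> rcases hc0.lt_or_gt with h2 | h2 <;>
            simp [h1, h2, sign_neg, sign_pos]
        split_ifs <;> first | omega | (exfalso; tauto)
      · split_ifs <;> omega

theorem countP_pos_add_countP_neg_add_count_zero (s : Multiset ℝ) :
    s.countP (0 < ·) + (s.map fun x => -x).countP (0 < ·) + s.count 0 = s.card := by
  induction s using Multiset.induction_on with
  | empty => simp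
  | cons a s ih =>
    rw [Multiset.map_cons, Multiset.countP_cons, Multiset.countP_cons, Multiset.count_cons,
      Multiset.card_cons]
    rcases lt_trichotomy a 0 with h | h | h
    · simp [h, h.not_gt, h.ne']; omega
    · simp [h]; omega
    · simp [h, h.not_gt, h.ne]; omega

open Polynomial in
/-- **Descartes' rule of signs** is exact for polynomials with real roots only. -/
theorem countP_pos_roots_eq_signVariations {P : ℝ[X]} (hP : P ≠ 0)
    (hs : P.roots.card = P.natDegree) :
    P.roots.countP (0 < ·) = P.signVariations ∧
      (P.comp (-X)).roots.countP (0 < ·) = (P.comp (-X)).signVariations := by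
  have h1 := roots_countP_pos_le_signVariations P
  have h2 := roots_countP_pos_le_signVariations (P.comp (-X))
  have h3 := signVariations_add_signVariations_comp_neg_le _ P (P.roots.count 0) hP rfl
    fun k hk => by
      rw [count_roots, rootMultiplicity_eq_natTrailingDegree'] at hk
      exact coeff_eq_zero_of_lt_natTrailingDegree hk
  -- Positive roots, negative roots and the multiplicity of 0 add up to the degree, which forces
  -- equality in both Descartes bounds.
  have h4 := countP_pos_add_countP_neg_add_count_zero P.roots
  rw [← roots_comp_neg_X] at h4
  omega

open Polynomial in
theorem signVariations_congr {P Q : ℝ[X]} (hdeg : P.degree = Q.degree)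
    (h : ∀ k, SignType.sign (P.coeff k) = SignType.sign (Q.coeff k)) :
    P.signVariations = Q.signVariations := by
  have : P.coeffList.map SignType.sign = Q.coeffList.map SignType.sign := by
    simp only [coeffList, List.map_map, hdeg]
    exact List.map_congr_left fun k _ => h k
  simp only [signVariations, this]

theorem sum_map_sign (s : Multiset ℝ) :
    (s.map fun x => (SignType.sign x : ℤ)).sum =
      s.countP (0 < ·) - (s.map fun x => -x).countP (0 < ·) := by
  induction s using Multiset.induction_on with
  | empty => simp
  | cons a s ih =>
    rw [Multiset.map_cons, Multiset.map_cons, Multiset.countP_cons, Multiset.countP_cons,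
      Multiset.sum_cons, ih]
    rcases lt_trichotomy a 0 with h | h | h
    · simp [h, h.not_gt]; ring
    · simp [h]
    · simp [h, h.not_gt]; ring

-- The number of positive roots minus the number of negative ones is the difference of the sign
-- variations of P(X) and P(-X), which see only the signs of the coefficients.
open Polynomial in
theorem sum_sign_eq_of_sign_coeff_eq {d : ℕ} (a a' : Fin d → ℝ)
    (h : ∀ k, SignType.sign ((∏ i, (X - C (a i))).coeff k) =
      SignType.sign ((∏ i, (X - C (a' i))).coeff k)) :
    ∑ i, (SignType.sign (a i) : ℤ) = ∑ i, (SignType.sign (a' i) : ℤ) := by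
  have hmon : ∀ a : Fin d → ℝ, (∏ i, (X - C (a i))).Monic := fun a =>
    monic_prod_of_monic _ _ fun i _ => monic_X_sub_C _
  have hroots : ∀ a : Fin d → ℝ, (∏ i, (X - C (a i))).roots = Finset.univ.val.map a := fun a => by
    rw [← roots_multiset_prod_X_sub_C (Finset.univ.val.map a), Multiset.map_map]; rfl
  have hdeg : ∀ a : Fin d → ℝ, (∏ i, (X - C (a i))).natDegree = d := fun a => by
    rw [natDegree_prod_of_monic _ _ fun i _ => monic_X_sub_C _]; simp
  have hsum : ∀ a : Fin d → ℝ, ∑ i, (SignType.sign (a i) : ℤ) =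
      ((∏ i, (X - C (a i))).signVariations : ℤ) -
        ((∏ i, (X - C (a i))).comp (-X)).signVariations := fun a => by
    have := countP_pos_roots_eq_signVariations (hmon a).ne_zero (by rw [hroots, hdeg]; simp)
    rw [← this.1, ← this.2, roots_comp_neg_X, ← sum_map_sign, hroots, Multiset.map_map]
    rfl
  have hd : (∏ i, (X - C (a i))).degree = (∏ i, (X - C (a' i))).degree := by
    rw [degree_eq_natDegree (hmon a).ne_zero, degree_eq_natDegree (hmon a').ne_zero, hdeg, hdeg]
  have h1 := signVariations_congr hd h
  have h2 := signVariations_congr (P := (∏ i, (X - C (a i))).comp (-X))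
    (Q := (∏ i, (X - C (a' i))).comp (-X)) (by rw [degree_comp_neg_X, degree_comp_neg_X, hd])
    fun k => by rw [coeff_comp_neg_X', coeff_comp_neg_X', sign_mul, sign_mul, h]
  rw [hsum, hsum, h1, h2]

/-! ### Semialgebraicity of the singular locus -/

theorem isSemialgebraic_empty {ι : Type} : IsSemialgebraic (∅ : Set (ι → ℝ)) := by
  simpa using IsSemialgebraic.pos (0 : MvPolynomial ι ℝ)

theorem isSemialgebraic_iUnion {ι κ : Type} [Finite κ] {A : κ → Set (ι → ℝ)}
    (h : ∀ k, IsSemialgebraic (A k)) : IsSemialgebraic (⋃ k, A k) := by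
  have : Fintype κ := Fintype.ofFinite κ
  have key : ∀ s : Finset κ, IsSemialgebraic (⋃ k ∈ s, A k) := fun s => by
    classical
    induction s using Finset.induction_on with
    | empty => simpa using isSemialgebraic_empty
    | insert a s _ ih => rw [Finset.set_biUnion_insert]; exact (h a).union ih
  simpa using key Finset.univ

theorem isSemialgebraic_iInter {ι κ : Type} [Finite κ] {A : κ → Set (ι → ℝ)}
    (h : ∀ k, IsSemialgebraic (A k)) : IsSemialgebraic (⋂ k, A k) := by
  rw [← compl_compl (⋂ k, A k), Set.compl_iInter]
  exact (isSemialgebraic_iUnion fun k => (h k).compl).compl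

theorem isSemialgebraic_sign_eq {ι : Type} (p : MvPolynomial ι ℝ) (s : SignType) :
    IsSemialgebraic {v | SignType.sign (MvPolynomial.eval v p) = s} := by
  have hpos := IsSemialgebraic.pos p
  have hneg := IsSemialgebraic.pos (-p)
  cases s with
  | pos => exact (by simpa [sign_eq_one_iff] using hpos)
  | neg => exact (by simpa [sign_eq_neg_one_iff] using hneg)
  | zero =>
    convert (hpos.union hneg).compl using 1
    ext v
    simp only [SignType.zero_eq_zero, sign_eq_zero_iff, Set.mem_ofPred_eq, map_neg,
      Set.mem_compl_iff, Set.mem_union, not_or, not_lt]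
    constructor
    · intro h; simp [h]
    · intro h; linarith [h.1, h.2]

/-- A set whose membership depends only on the signs of finitely many polynomials is
semialgebraic. -/
theorem isSemialgebraic_of_sign {ι κ : Type} [Finite κ] (p : κ → MvPolynomial ι ℝ)
    {A : Set (ι → ℝ)}
    (h : ∀ v w, (∀ k, SignType.sign (MvPolynomial.eval v (p k)) =
      SignType.sign (MvPolynomial.eval w (p k))) → v ∈ A → w ∈ A) : IsSemialgebraic A := by
  have hA : A = ⋃ s : {s : κ → SignType // ∃ v ∈ A, ∀ k,
      SignType.sign (MvPolynomial.eval v (p k)) = s k},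
      ⋂ k, {v | SignType.sign (MvPolynomial.eval v (p k)) = s.1 k} := by
    ext w
    simp only [Set.mem_iUnion, Set.mem_iInter, Set.mem_ofPred_eq]
    constructor
    · intro hw
      exact ⟨⟨fun k => SignType.sign (MvPolynomial.eval w (p k)), w, hw, fun _ => rfl⟩,
        fun _ => rfl⟩
    · rintro ⟨⟨s, v, hv, hs⟩, hw⟩
      exact h v w (fun k => (hs k).trans (hw k).symm) hv
  rw [hA]
  exact isSemialgebraic_iUnion fun s => isSemialgebraic_iInter fun k =>
    isSemialgebraic_sign_eq _ _

open Polynomial in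
/-- The smallest of finitely many reals is simple iff some shift of their polynomial by one of them
has positive coefficients in positive degrees. -/
theorem exists_coeff_pos_iff {d : ℕ} (a : Fin d → ℝ) :
    (∃ b, ∀ k : Fin d, (k : ℕ) ≠ 0 → 0 < (∏ j, (X + C (a j - a b))).coeff k) ↔
      ∃ b, ∀ j, j ≠ b → a b < a j := by
  refine exists_congr fun b => ?_
  -- The factor at j = b is X, so degrees 1, …, d - 1 of the product are degrees 0, …, d - 2 of g;
  -- the top coefficient of g is 1.
  have hfac : ∏ j, (X + C (a j - a b)) = X * ∏ j ∈ Finset.univ.erase b, (X + C (a j - a b)) := by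
    rw [← Finset.mul_prod_erase _ _ (Finset.mem_univ b)]; simp
  set g := ∏ j ∈ Finset.univ.erase b, (X + C (a j - a b)) with hg
  have hdeg : g.natDegree + 1 = d := by
    rw [hg, natDegree_prod_of_monic _ _ fun i _ => monic_X_add_C _]
    simp only [natDegree_X_add_C, Finset.sum_const, smul_eq_mul, mul_one, Finset.mem_univ,
      Finset.card_erase_of_mem, Finset.card_univ, Fintype.card_fin, Nat.sub_add_cancel b.pos]
  have hmon : g.Monic := monic_prod_of_monic _ _ fun i _ => monic_X_add_C _
  rw [hfac]
  constructor
  · intro h j hj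
    -- Then a b - a j ≥ 0 would be a root of g, impossible for a polynomial with positive
    -- coefficients.
    by_contra! hlt
    have hroot : g.eval (a b - a j) = 0 := by
      rw [hg, eval_prod]
      exact Finset.prod_eq_zero (Finset.mem_erase.2 ⟨hj, Finset.mem_univ j⟩) (by simp)
    have hcoeff : ∀ k, k ≤ g.natDegree → 0 < g.coeff k := fun k hk => by
      rcases hk.eq_or_lt with rfl | hk
      · rw [hmon.coeff_natDegree]; exact one_pos
      · simpa [coeff_X_mul] using h ⟨k + 1, by omega⟩ (by simp)
    refine absurd hroot (ne_of_gt ?_)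
    rw [eval_eq_sum_range]
    refine Finset.sum_pos' (fun k hk => mul_nonneg (hcoeff k ?_).le (pow_nonneg (by linarith) k))
      ⟨0, by simp, by simpa using hcoeff 0 (Nat.zero_le _)⟩
    exact Nat.lt_succ_iff.1 (Finset.mem_range.1 hk)
  · intro h k hk
    obtain ⟨m, hm⟩ := Nat.exists_eq_succ_of_ne_zero hk
    rw [hm, Nat.succ_eq_add_one, coeff_X_mul]
    have hmd : m ≤ g.natDegree := by have := k.2; omega
    have : ∀ s : Finset (Fin d), (∀ j ∈ s, a b < a j) → ∀ m ≤ s.card,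
        0 < (∏ j ∈ s, (X + C (a j - a b))).coeff m := fun s => by
      classical
      induction s using Finset.induction_on with
      | empty => intro _ m hm; simp at hm; simp [hm]
      | insert i s his ih =>
        intro hs m hm
        rw [Finset.prod_insert his, add_mul, coeff_add, coeff_C_mul]
        have hpos : 0 < a i - a b := sub_pos.2 (hs i (Finset.mem_insert_self i s))
        have ih' := ih fun j hj => hs j (Finset.mem_insert_of_mem hj)
        rw [Finset.card_insert_of_notMem his] at hm
        have hdeg' : (∏ j ∈ s, (X + C (a j - a b))).natDegree = s.card := by
          rw [natDegree_prod_of_monic _ _ fun i _ => monic_X_add_C _]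
          simp only [natDegree_X_add_C, Finset.sum_const, smul_eq_mul, mul_one]
        cases m with
        | zero =>
          simp only [coeff_X_mul_zero, zero_add]
          exact mul_pos hpos (ih' 0 (Nat.zero_le _))
        | succ m =>
          rw [coeff_X_mul]
          refine add_pos_of_pos_of_nonneg (ih' m (by omega)) (mul_nonneg hpos.le ?_)
          rcases hm.eq_or_lt with h1 | h1
          · rw [coeff_eq_zero_of_natDegree_lt (by omega)]
          · exact (ih' (m + 1) (by omega)).le
    refine this _ (fun j hj => h j (Finset.ne_of_mem_erase hj)) m ?_
    rw [Finset.card_erase_of_mem (Finset.mem_univ b), Finset.card_univ, Fintype.card_fin]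
    omega

-- This is the Taylor expansion at t. It makes the shifted coefficients polynomial in t and in the
-- coefficients of the unshifted product, so they can be evaluated at an unknown eigenvalue.
open Polynomial in
theorem coeff_prod_X_add_C_sub {d : ℕ} (a : Fin d → ℝ) (t : ℝ) (k : ℕ) :
    (∏ j, (X + C (a j - t))).coeff k =
      (-1) ^ (d + k) * (hasseDeriv k (∏ j, (X - C (a j)))).eval t := by
  have h : ∏ j, (X + C (a j - t)) =
      C ((-1) ^ d) * (taylor t (∏ j, (X - C (a j)))).comp (-X) := by
    rw [taylor_apply, prod_comp, prod_comp]
    have : ((-1 : ℝ) ^ d) = ∏ _j : Fin d, (-1 : ℝ) := by simp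
    rw [this, map_prod, ← Finset.prod_mul_distrib]
    refine Finset.prod_congr rfl fun j _ => ?_
    simp
    ring
  rw [h, coeff_C_mul, coeff_comp_neg_X', taylor_coeff, pow_add]
  ring

open Polynomial in
theorem hasseDeriv_map {R S : Type*} [CommRing R] [CommRing S] (f : R →+* S) (k : ℕ) (P : R[X]) :
    (hasseDeriv k P).map f = hasseDeriv k (P.map f) := by
  ext n
  simp [hasseDeriv_coeff]

open Polynomial in
theorem aeval_transpose_mul_diagonal_mul {d : ℕ} {V : Matrix (Fin d) (Fin d) ℝ}
    (hV : V ∈ Matrix.orthogonalGroup (Fin d) ℝ) (a : Fin d → ℝ) (g : ℝ[X]) :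
    aeval (Vᵀ * Matrix.diagonal a * V) g = Vᵀ * Matrix.diagonal (fun i => g.eval (a i)) * V := by
  have hpow : ∀ n : ℕ, (Vᵀ * Matrix.diagonal a * V) ^ n =
      Vᵀ * Matrix.diagonal (fun i => a i ^ n) * V := fun n => by
    induction n with
    | zero => simp [transpose_mul_self_of_mem hV, Matrix.diagonal_one]
    | succ n ih =>
      have h1 : Matrix.diagonal (fun i => a i ^ (n + 1)) =
          Matrix.diagonal (fun i => a i ^ n) * Matrix.diagonal a := by
        rw [Matrix.diagonal_mul_diagonal]; simp [pow_succ]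
      rw [pow_succ, ih, h1]
      calc _ = Vᵀ * Matrix.diagonal (fun i => a i ^ n) * (V * Vᵀ) * Matrix.diagonal a * V := by
            simp only [mul_assoc]
        _ = _ := by rw [mul_transpose_self_of_mem hV, mul_one]; simp only [mul_assoc]
  induction g using Polynomial.induction_on' with
  | add p q hp hq =>
    rw [map_add, hp, hq, ← add_mul, ← mul_add, Matrix.diagonal_add]
    simp
  | monomial n c =>
    rw [aeval_monomial, hpow, ← Algebra.smul_def, ← smul_mul_assoc, ← mul_smul_comm,
      ← Matrix.diagonal_smul]
    congr 3
    ext i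
    simp

open Polynomial in
theorem map_aeval_genericGram {d : ℕ} (q : Matrix (Fin d) (Fin d) ℝ)
    (P : (MvPolynomial (Fin d × Fin d) ℝ)[X]) :
    (aeval (genericGram d) P).map (evalAt q) = aeval (qᵀ * q) (P.map (evalAt q)) := by
  have h := map_aeval_eq_aeval_map (R := MvPolynomial (Fin d × Fin d) ℝ)
    (S := Matrix (Fin d) (Fin d) (MvPolynomial (Fin d × Fin d) ℝ)) (T := ℝ)
    (U := Matrix (Fin d) (Fin d) ℝ) (φ := evalAt q) (ψ := (evalAt q).mapMatrix) ?_ P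
    (genericGram d)
  · rw [RingHom.mapMatrix_apply, RingHom.mapMatrix_apply, genericGram_map] at h
    exact h
  · refine RingHom.ext fun r => ?_
    ext i j
    simp only [RingHom.comp_apply, RingHom.mapMatrix_apply, Matrix.map_apply,
      Matrix.algebraMap_matrix_apply]
    split_ifs <;> simp

theorem mem_singularLocus_iff {d : ℕ} {U V : Matrix (Fin d) (Fin d) ℝ}
    (hd : 0 < d) (hU : U ∈ Matrix.orthogonalGroup (Fin d) ℝ)
    (hV : V ∈ Matrix.orthogonalGroup (Fin d) ℝ) (x : Fin d → ℝ) :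
    U * Matrix.diagonal x * V ∈ singularLocus d ↔ ¬ ∃ b, ∀ j, j ≠ b → |x b| < |x j| := by
  constructor
  · rintro h ⟨b, hb⟩
    exact h (contDiffAt_signedDist_of_lt hU hV x hb)
  · intro h
    have : Nonempty (Fin d) := ⟨⟨0, hd⟩⟩
    obtain ⟨b, hb⟩ := Finite.exists_min fun i : Fin d => |x i|
    push Not at h
    obtain ⟨j, hj, hle⟩ := h b
    exact mem_singularLocus_of_eq hU hV x hb hj (le_antisymm hle (hb j))

open Polynomial in
/-- At an eigenvalue `t` of `qᵀ * q`, the `k`-th coefficient of `∏ j, (X + (t j - t))`, where `t j`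
runs over all eigenvalues. -/
noncomputable def shiftCoeff (d k : ℕ) : (MvPolynomial (Fin d × Fin d) ℝ)[X] :=
  C ((-1) ^ (d + k)) * hasseDeriv k (genericGram d).charpoly

open Polynomial in
theorem eval_shiftCoeff {d : ℕ} {U V : Matrix (Fin d) (Fin d) ℝ}
    (hU : U ∈ Matrix.orthogonalGroup (Fin d) ℝ) (hV : V ∈ Matrix.orthogonalGroup (Fin d) ℝ)
    (x : Fin d → ℝ) (k : ℕ) (t : ℝ) :
    ((shiftCoeff d k).map (evalAt (U * Matrix.diagonal x * V))).eval t =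
      (∏ j, (X + C (x j ^ 2 - t))).coeff k := by
  rw [coeff_prod_X_add_C_sub, ← charpoly_gram hU hV, shiftCoeff, Polynomial.map_mul,
    hasseDeriv_map, charpoly_genericGram_map]
  simp

/-- The positive degrees below `d`. -/
def positiveDegrees (d : ℕ) : Finset (Fin d) := Finset.univ.filter fun k => (k : ℕ) ≠ 0

-- For a sign s, the number s + s² is 2 if s = 1 and 0 otherwise. Expanding ∏ (s_k + s_k²) over
-- subsets T writes the test "all s_k = 1" as a sum of terms, each the sign of the single polynomial
-- `shiftProd d T`.
open Polynomial in
noncomputable def shiftProd (d : ℕ) (T : Finset (Fin d)) : (MvPolynomial (Fin d × Fin d) ℝ)[X] :=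
  (∏ k ∈ T, shiftCoeff d k) * ∏ k ∈ positiveDegrees d \ T, shiftCoeff d k ^ 2

theorem signType_add_sq_nonneg (s : SignType) : 0 ≤ (s : ℤ) + (s : ℤ) ^ 2 := by
  cases s <;> simp

theorem signType_add_sq_pos_iff (s : SignType) : 0 < (s : ℤ) + (s : ℤ) ^ 2 ↔ s = 1 := by
  cases s <;> simp

-- After exchanging the sums, `Finset.prod_add` collapses the sum over T. The product left for index
-- i is positive exactly when all its shifted coefficients are positive, which is the criterion of
-- `exists_coeff_pos_iff`.
open Polynomial in
theorem sum_sign_shiftProd_pos_iff {d : ℕ} {U V : Matrix (Fin d) (Fin d) ℝ}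
    (hU : U ∈ Matrix.orthogonalGroup (Fin d) ℝ) (hV : V ∈ Matrix.orthogonalGroup (Fin d) ℝ)
    (x : Fin d → ℝ) :
    0 < ∑ T ∈ (positiveDegrees d).powerset, ∑ i, (SignType.sign
        (((shiftProd d T).map (evalAt (U * Matrix.diagonal x * V))).eval (x i ^ 2)) : ℤ) ↔
      ∃ b, ∀ j, j ≠ b → |x b| < |x j| := by
  set c : Fin d → Fin d → ℝ := fun i k => (∏ j, (X + C (x j ^ 2 - x i ^ 2))).coeff k with hc
  have hsign : ∀ T i, (SignType.sign
      (((shiftProd d T).map (evalAt (U * Matrix.diagonal x * V))).eval (x i ^ 2)) : ℤ) =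
      (∏ k ∈ T, (SignType.sign (c i k) : ℤ)) *
        ∏ k ∈ positiveDegrees d \ T, (SignType.sign (c i k) : ℤ) ^ 2 := fun T i => by
    rw [shiftProd, Polynomial.map_mul, Polynomial.map_prod, Polynomial.map_prod, eval_mul,
      eval_prod, eval_prod]
    simp only [Polynomial.map_pow, eval_pow, eval_shiftCoeff hU hV]
    have hp : ∀ s : Finset (Fin d), ∀ f : Fin d → ℝ,
        (SignType.sign (∏ k ∈ s, f k) : ℤ) = ∏ k ∈ s, (SignType.sign (f k) : ℤ) := fun s f => by
      have h1 := map_prod (signHom (α := ℝ)) f s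
      have h2 := map_prod (SignType.castHom (α := ℤ)) (fun k => SignType.sign (f k)) s
      exact (congrArg (SignType.castHom (α := ℤ)) h1).trans h2
    rw [sign_mul, SignType.coe_mul, hp, hp]
    simp only [sign_pow, SignType.coe_pow]
    rfl
  simp only [hsign]
  rw [Finset.sum_comm]
  simp only [← Finset.prod_add]
  have hsq : (∃ b, ∀ j, j ≠ b → |x b| < |x j|) ↔ ∃ b, ∀ j, j ≠ b → x b ^ 2 < x j ^ 2 := by
    simp only [sq_lt_sq]
  rw [hsq, ← exists_coeff_pos_iff fun i => x i ^ 2]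
  have hnn : ∀ i ∈ Finset.univ, (0 : ℤ) ≤ ∏ k ∈ positiveDegrees d,
      ((SignType.sign (c i k) : ℤ) + (SignType.sign (c i k) : ℤ) ^ 2) := fun i _ =>
    Finset.prod_nonneg fun k _ => signType_add_sq_nonneg _
  rw [Finset.sum_pos_iff_of_nonneg hnn]
  refine exists_congr fun i => ?_
  simp only [Finset.mem_univ, true_and]
  constructor
  · intro h k hk
    have h1 := Finset.prod_ne_zero_iff.1 h.ne' k (by simpa [positiveDegrees] using hk)
    have h2 := (signType_add_sq_pos_iff _).1 (lt_of_le_of_ne (signType_add_sq_nonneg _) h1.symm)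
    exact sign_eq_one_iff.1 h2
  · intro h
    refine Finset.prod_pos fun k hk => (signType_add_sq_pos_iff _).2 (sign_eq_one_iff.2 ?_)
    exact h k (by simpa [positiveDegrees] using hk)

open Polynomial in
theorem evalAt_coeff_charpoly_aeval {d : ℕ} {U V : Matrix (Fin d) (Fin d) ℝ}
    (hU : U ∈ Matrix.orthogonalGroup (Fin d) ℝ) (hV : V ∈ Matrix.orthogonalGroup (Fin d) ℝ)
    (x : Fin d → ℝ) (P : (MvPolynomial (Fin d × Fin d) ℝ)[X]) (k : ℕ) :
    evalAt (U * Matrix.diagonal x * V) ((aeval (genericGram d) P).charpoly.coeff k) =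
      (∏ i, (X - C ((P.map (evalAt (U * Matrix.diagonal x * V))).eval (x i ^ 2)))).coeff k := by
  rw [← coeff_map, ← Matrix.charpoly_map, map_aeval_genericGram,
    transpose_mul_self_mul_diagonal_mul hU, aeval_transpose_mul_diagonal_mul hV,
    charpoly_transpose_mul_mul hV]

-- For fixed T the sum of signs is the signature of the symmetric matrix obtained by evaluating
-- `shiftProd d T` at qᵀq. It is determined by the signs of the coefficients of that matrix's
-- characteristic polynomial, which are polynomials in the entries of q.
open Polynomial in
theorem isSemialgebraicMatrixSet_singularLocus {d : ℕ} (hd : 0 < d) :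
    IsSemialgebraicMatrixSet (singularLocus d) := by
  refine isSemialgebraic_of_sign (κ := Finset (Fin d) × Fin (d + 1))
    (fun z => (aeval (genericGram d) (shiftProd d z.1)).charpoly.coeff z.2) fun v w h hv => ?_
  simp only [Set.mem_ofPred_eq] at hv ⊢
  replace h : ∀ z : Finset (Fin d) × Fin (d + 1),
      SignType.sign (evalAt (Matrix.of fun i j => v (i, j))
        ((aeval (genericGram d) (shiftProd d z.1)).charpoly.coeff z.2)) =
      SignType.sign (evalAt (Matrix.of fun i j => w (i, j))
        ((aeval (genericGram d) (shiftProd d z.1)).charpoly.coeff z.2)) := h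
  obtain ⟨U, hU, V, hV, x, -, -, hx⟩ :=
    exists_diagonal_decomposition hd (Matrix.of fun i j => v (i, j))
  obtain ⟨U', hU', V', hV', x', -, -, hx'⟩ :=
    exists_diagonal_decomposition hd (Matrix.of fun i j => w (i, j))
  rw [hx, hx'] at h
  rw [hx, mem_singularLocus_iff hd hU hV, ← sum_sign_shiftProd_pos_iff hU hV] at hv
  rw [hx', mem_singularLocus_iff hd hU' hV', ← sum_sign_shiftProd_pos_iff hU' hV']
  rw [not_lt] at hv ⊢
  refine le_of_eq_of_le ?_ hv
  refine Finset.sum_congr rfl fun T _ => sum_sign_eq_of_sign_coeff_eq _ _ fun k => ?_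
  have hdeg : ∀ a : Fin d → ℝ, (∏ i, (X - C (a i))).natDegree = d := fun a => by
    rw [natDegree_prod_of_monic _ _ fun i _ => monic_X_sub_C _]; simp
  rcases lt_or_ge d k with hk | hk
  · rw [coeff_eq_zero_of_natDegree_lt (by rwa [hdeg]),
      coeff_eq_zero_of_natDegree_lt (by rwa [hdeg])]
  · have := h (T, ⟨k, Nat.lt_succ_of_le hk⟩)
    rw [evalAt_coeff_charpoly_aeval hU hV, evalAt_coeff_charpoly_aeval hU' hV'] at this
    exact this.symm

/-! ### Upper bound for the dimension: Euler angles -/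

open scoped Pointwise

theorem contDiff_matrix_entry {E : Type*} [NormedAddCommGroup E] [NormedSpace ℝ E] {d : ℕ}
    {n : WithTop ℕ∞} {f : E → Matrix (Fin d) (Fin d) ℝ} (hf : ContDiff ℝ n f) (i j : Fin d) :
    ContDiff ℝ n fun t => f t i j :=
  (LinearMap.toContinuousLinearMap (Matrix.entryLinearMap ℝ ℝ i j)).contDiff.comp hf

theorem contDiff_matrix {E : Type*} [NormedAddCommGroup E] [NormedSpace ℝ E] {d : ℕ}
    {n : WithTop ℕ∞} {f : E → Matrix (Fin d) (Fin d) ℝ}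
    (hf : ∀ i j, ContDiff ℝ n fun t => f t i j) : ContDiff ℝ n f := by
  have h : f = fun t => ∑ i, ∑ j, f t i j • Matrix.single i j (1 : ℝ) := by
    ext1 t
    conv_lhs => rw [Matrix.matrix_eq_sum_single (f t)]
    simp
  rw [h]
  exact ContDiff.sum fun i _ => ContDiff.sum fun j _ => (hf i j).smul contDiff_const

theorem contDiff_matrix_mul {E : Type*} [NormedAddCommGroup E] [NormedSpace ℝ E] {d : ℕ}
    {n : WithTop ℕ∞} {f g : E → Matrix (Fin d) (Fin d) ℝ} (hf : ContDiff ℝ n f)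
    (hg : ContDiff ℝ n g) : ContDiff ℝ n fun t => f t * g t :=
  contDiff_matrix fun i j => by
    simp only [Matrix.mul_apply]
    exact ContDiff.sum fun k _ => (contDiff_matrix_entry hf i k).mul (contDiff_matrix_entry hg k j)

/-- A set of matrices contained in the image of a `C¹` map with `n` real parameters. -/
def SmoothlyCovered {d : ℕ} (n : ℕ) (A : Set (Matrix (Fin d) (Fin d) ℝ)) : Prop :=
  ∃ f : (Fin n → ℝ) → Matrix (Fin d) (Fin d) ℝ, ContDiff ℝ 1 f ∧ A ⊆ Set.range f

theorem SmoothlyCovered.dimH_le {d n : ℕ} {A : Set (Matrix (Fin d) (Fin d) ℝ)}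
    (h : SmoothlyCovered n A) : dimH A ≤ n := by
  obtain ⟨f, hf, hA⟩ := h
  simpa using (dimH_mono hA).trans hf.dimH_range_le

theorem SmoothlyCovered.mul {d n m : ℕ} {A B : Set (Matrix (Fin d) (Fin d) ℝ)}
    (hA : SmoothlyCovered n A) (hB : SmoothlyCovered m B) : SmoothlyCovered (n + m) (A * B) := by
  obtain ⟨f, hf, hfA⟩ := hA
  obtain ⟨g, hg, hgB⟩ := hB
  refine ⟨fun t => f (fun i => t (Fin.castAdd m i)) * g (fun i => t (Fin.natAdd n i)),
    contDiff_matrix_mul (hf.comp (by fun_prop)) (hg.comp (by fun_prop)), ?_⟩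
  rintro _ ⟨a, ha, b, hb, rfl⟩
  obtain ⟨u, rfl⟩ := hfA ha
  obtain ⟨v, rfl⟩ := hgB hb
  exact ⟨Fin.append u v, by simp⟩

theorem SmoothlyCovered.transpose {d n : ℕ} {A : Set (Matrix (Fin d) (Fin d) ℝ)}
    (hA : SmoothlyCovered n A) : SmoothlyCovered n (Matrix.transpose '' A) := by
  obtain ⟨f, hf, hfA⟩ := hA
  refine ⟨fun t => (f t)ᵀ, contDiff_matrix fun i j => contDiff_matrix_entry hf j i, ?_⟩
  rintro _ ⟨a, ha, rfl⟩
  obtain ⟨u, rfl⟩ := hfA ha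
  exact ⟨u, rfl⟩

theorem smoothlyCovered_one (d : ℕ) :
    SmoothlyCovered 0 ({1} : Set (Matrix (Fin d) (Fin d) ℝ)) :=
  ⟨fun _ => 1, contDiff_const, by rintro _ rfl; exact ⟨0, rfl⟩⟩

/-- The rotation by the angle `θ` in the plane of the coordinates `p` and `r`. -/
noncomputable def planeRotation {d : ℕ} (p r : Fin d) (θ : ℝ) : Matrix (Fin d) (Fin d) ℝ :=
  Matrix.of fun a l => if a = p then Real.cos θ * (1 : Matrix (Fin d) (Fin d) ℝ) p l -
      Real.sin θ * (1 : Matrix (Fin d) (Fin d) ℝ) r l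
    else if a = r then Real.sin θ * (1 : Matrix (Fin d) (Fin d) ℝ) p l +
      Real.cos θ * (1 : Matrix (Fin d) (Fin d) ℝ) r l
    else (1 : Matrix (Fin d) (Fin d) ℝ) a l

theorem planeRotation_mul_apply {d : ℕ} (p r : Fin d) (θ : ℝ) (M : Matrix (Fin d) (Fin d) ℝ)
    (a l : Fin d) : (planeRotation p r θ * M) a l =
      if a = p then Real.cos θ * M p l - Real.sin θ * M r l
      else if a = r then Real.sin θ * M p l + Real.cos θ * M r l else M a l := by
  have h : ∀ b : Fin d, ∑ x, (1 : Matrix (Fin d) (Fin d) ℝ) b x * M x l = M b l := fun b => by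
    rw [← Matrix.mul_apply, one_mul]
  simp only [Matrix.mul_apply, planeRotation, Matrix.of_apply]
  split_ifs
  · simp only [sub_mul, mul_assoc, Finset.sum_sub_distrib, ← Finset.mul_sum, h]
  · simp only [add_mul, mul_assoc, Finset.sum_add_distrib, ← Finset.mul_sum, h]
  · exact h a

theorem planeRotation_mul_neg {d : ℕ} {p r : Fin d} (hpr : p ≠ r) (θ : ℝ)
    (M : Matrix (Fin d) (Fin d) ℝ) :
    planeRotation p r θ * (planeRotation p r (-θ) * M) = M := by
  have h := Real.sin_sq_add_cos_sq θ
  ext a l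
  simp only [planeRotation_mul_apply, Real.cos_neg, Real.sin_neg, if_true, hpr.symm, if_false]
  split_ifs with h1 h2
  · subst h1; linear_combination M a l * h
  · subst h2; linear_combination M a l * h
  · rfl

theorem planeRotation_transpose {d : ℕ} {p r : Fin d} (hpr : p ≠ r) (θ : ℝ) :
    (planeRotation p r θ)ᵀ = planeRotation p r (-θ) := by
  ext a l
  simp only [Matrix.transpose_apply, planeRotation, Matrix.of_apply, Real.cos_neg, Real.sin_neg,
    Matrix.one_apply]
  by_cases h1 : a = p <;> by_cases h2 : l = p <;> by_cases h3 : a = r <;> by_cases h4 : l = r <;>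
    simp_all [eq_comm]

theorem planeRotation_mem {d : ℕ} {p r : Fin d} (hpr : p ≠ r) (θ : ℝ) :
    planeRotation p r θ ∈ Matrix.orthogonalGroup (Fin d) ℝ := by
  rw [Matrix.mem_orthogonalGroup_iff]
  change _ * (planeRotation p r θ)ᵀ = 1
  rw [planeRotation_transpose hpr]
  simpa using planeRotation_mul_neg hpr θ 1

theorem smoothlyCovered_planeRotation {d : ℕ} (p r : Fin d) :
    SmoothlyCovered 1 (Set.range (planeRotation p r)) := by
  refine ⟨fun t => planeRotation p r (t 0), contDiff_matrix fun i j => ?_, ?_⟩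
  · simp only [planeRotation, Matrix.of_apply]
    split_ifs <;> fun_prop
  · rintro _ ⟨θ, rfl⟩
    exact ⟨fun _ => θ, rfl⟩

/-- The orthogonal matrices that fix the first `k` basis vectors. -/
def fixingGroup (d k : ℕ) : Set (Matrix (Fin d) (Fin d) ℝ) :=
  {U | U ∈ Matrix.orthogonalGroup (Fin d) ℝ ∧
    ∀ l : Fin d, (l : ℕ) < k → ∀ i, U i l = (1 : Matrix (Fin d) (Fin d) ℝ) i l}

theorem planeRotation_mul_mem_fixingGroup {d k : ℕ} {p r : Fin d} (hpr : p ≠ r) (hp : k ≤ p)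
    (hr : k ≤ r) (θ : ℝ) {U : Matrix (Fin d) (Fin d) ℝ} (hU : U ∈ fixingGroup d k) :
    planeRotation p r θ * U ∈ fixingGroup d k := by
  refine ⟨mul_mem (planeRotation_mem hpr θ) hU.1, fun l hl i => ?_⟩
  have h1 : p ≠ l := fun h => by subst h; omega
  have h2 : r ≠ l := fun h => by subst h; omega
  rw [planeRotation_mul_apply, hU.2 l hl, hU.2 l hl, hU.2 l hl]
  split_ifs with h3 h4
  · subst h3; simp [h1, h2]
  · subst h4; simp [h1, h2]
  · rfl

theorem exists_planeRotation_entry {d : ℕ} {p r : Fin d} (hpr : p ≠ r)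
    (U : Matrix (Fin d) (Fin d) ℝ) (l : Fin d) :
    ∃ θ, (planeRotation p r (-θ) * U) r l = 0 ∧ 0 ≤ (planeRotation p r (-θ) * U) p l := by
  -- Rotating by minus the argument puts the pair of entries on the nonnegative real axis.
  set z : ℂ := ⟨U p l, U r l⟩
  refine ⟨z.arg, ?_, ?_⟩
  · rw [planeRotation_mul_apply, if_neg hpr.symm, if_pos rfl, Real.cos_neg, Real.sin_neg]
    have h1 := Complex.norm_mul_cos_arg z
    have h2 := Complex.norm_mul_sin_arg z
    linear_combination Real.sin z.arg * h1 - Real.cos z.arg * h2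
  · rw [planeRotation_mul_apply, if_pos rfl, Real.cos_neg, Real.sin_neg]
    have h1 := Complex.norm_mul_cos_arg z
    have h2 := Complex.norm_mul_sin_arg z
    have h3 := Real.sin_sq_add_cos_sq z.arg
    have h4 : Real.cos z.arg * U p l - -Real.sin z.arg * U r l = ‖z‖ := by
      linear_combination (-Real.cos z.arg) * h1 - Real.sin z.arg * h2 + ‖z‖ * h3
    rw [h4]
    exact norm_nonneg z

theorem exists_rotation_step {d k : ℕ} (hk : k < d) {p r : Fin d} (hpr : p ≠ r) (hp : k ≤ p)
    (hr : k ≤ r) {U : Matrix (Fin d) (Fin d) ℝ} (hU : U ∈ fixingGroup d k) :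
    ∃ θ, ∃ W ∈ fixingGroup d k, U = planeRotation p r θ * W ∧ W r ⟨k, hk⟩ = 0 ∧
      0 ≤ W p ⟨k, hk⟩ ∧ ∀ i, i ≠ p → i ≠ r → W i ⟨k, hk⟩ = U i ⟨k, hk⟩ := by
  obtain ⟨θ, h1, h2⟩ := exists_planeRotation_entry hpr U ⟨k, hk⟩
  refine ⟨θ, _, planeRotation_mul_mem_fixingGroup hpr hp hr (-θ) hU,
    (planeRotation_mul_neg hpr θ U).symm, h1, h2, fun i hip hir => ?_⟩
  rw [planeRotation_mul_apply, if_neg hip, if_neg hir]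

/-- Rotations in the planes of consecutive coordinates clear a column from below. -/
theorem exists_column_reduction {d k : ℕ} (hk : k < d) (j : ℕ) (hj : j + k + 1 ≤ d) :
    ∃ C : Set (Matrix (Fin d) (Fin d) ℝ), SmoothlyCovered j C ∧
      ∀ U ∈ fixingGroup d k, ∃ R ∈ C, ∃ W ∈ fixingGroup d k, U = R * W ∧
        (∀ i : Fin d, d < i + j + 1 → W i ⟨k, hk⟩ = 0) ∧
        (0 < j → ∀ i : Fin d, (i : ℕ) + j + 1 = d → 0 ≤ W i ⟨k, hk⟩) := by
  induction j with
  | zero =>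
    refine ⟨{1}, smoothlyCovered_one d, fun U hU => ⟨1, rfl, U, hU, (one_mul U).symm, ?_, ?_⟩⟩
    · intro i hi; have := i.2; omega
    · intro h; omega
  | succ j ih =>
    obtain ⟨C, hC, h⟩ := ih (by omega)
    -- The last j rows of the column are already clear. The next rotation clears row d - 1 - j and
    -- leaves row d - 2 - j nonnegative.
    set p : Fin d := ⟨d - 2 - j, by omega⟩ with hp
    set r : Fin d := ⟨d - 1 - j, by omega⟩ with hr
    have hpr : p ≠ r := by rw [Ne, Fin.ext_iff]; simp only [hp, hr]; omega
    refine ⟨C * Set.range (planeRotation p r), hC.mul (smoothlyCovered_planeRotation p r),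
      fun U hU => ?_⟩
    obtain ⟨R, hR, W, hW, rfl, hW1, -⟩ := h U hU
    obtain ⟨θ, W', hW', rfl, h0, hnn, hsame⟩ :=
      exists_rotation_step hk hpr (by simp only [hp]; omega) (by simp only [hr]; omega) hW
    refine ⟨R * planeRotation p r θ, ⟨R, hR, _, ⟨θ, rfl⟩, rfl⟩, W', hW', (mul_assoc _ _ _).symm,
      fun i hi => ?_, fun _ i hi => ?_⟩
    · by_cases hir : i = r
      · rw [hir]; exact h0
      · have hir' : (i : ℕ) ≠ d - 1 - j := fun h => hir (Fin.ext h)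
        have hip : i ≠ p := fun h => by rw [h] at hi; simp only [hp] at hi; omega
        rw [hsame i hip hir]
        exact hW1 i (by omega)
    · have hip : i = p := Fin.ext (by simp only [hp]; omega)
      rw [hip]; exact hnn

/-- Entries above the diagonal vanish by orthogonality to the first k columns, which are basis
vectors; the unit length of the column then gives the diagonal entry. -/
theorem fixingGroup_column {d k : ℕ} (hk : k < d) {W : Matrix (Fin d) (Fin d) ℝ}
    (hW : W ∈ fixingGroup d k) (h0 : ∀ i : Fin d, k < i → W i ⟨k, hk⟩ = 0) :
    (∀ i : Fin d, (i : ℕ) ≠ k → W i ⟨k, hk⟩ = 0) ∧ W ⟨k, hk⟩ ⟨k, hk⟩ * W ⟨k, hk⟩ ⟨k, hk⟩ = 1 := by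
  have hWW := transpose_mul_self_of_mem hW.1
  have h1 : ∀ i : Fin d, (i : ℕ) ≠ k → W i ⟨k, hk⟩ = 0 := fun i hi => by
    rcases hi.lt_or_gt with h | h
    · have h2 := congrFun (congrFun hWW i) ⟨k, hk⟩
      rw [Matrix.mul_apply, Matrix.one_apply_ne (fun h => hi (congrArg Fin.val h))] at h2
      simpa [hW.2 i h, Matrix.one_apply] using h2
    · exact h0 i h
  refine ⟨h1, ?_⟩
  have h2 := congrFun (congrFun hWW ⟨k, hk⟩) ⟨k, hk⟩
  rw [Matrix.mul_apply, Matrix.one_apply_eq, Finset.sum_eq_single ⟨k, hk⟩] at h2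
  · simpa using h2
  · intro i _ hi
    rw [h1 i fun h => hi (Fin.ext h), mul_zero]
  · simp

theorem mem_fixingGroup_succ {d k : ℕ} (hk : k < d) {W : Matrix (Fin d) (Fin d) ℝ}
    (hW : W ∈ fixingGroup d k) (h0 : ∀ i : Fin d, k < i → W i ⟨k, hk⟩ = 0)
    (hnn : 0 ≤ W ⟨k, hk⟩ ⟨k, hk⟩) : W ∈ fixingGroup d (k + 1) := by
  obtain ⟨h1, h2⟩ := fixingGroup_column hk hW h0
  refine ⟨hW.1, fun l hl i => ?_⟩
  rcases (Nat.lt_succ_iff.1 hl).lt_or_eq with h | h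
  · exact hW.2 l h i
  · have hlk : l = ⟨k, hk⟩ := Fin.ext h
    subst hlk
    by_cases hi : i = ⟨k, hk⟩
    · rw [hi, Matrix.one_apply_eq]
      nlinarith
    · rw [Matrix.one_apply_ne hi]
      exact h1 i fun h => hi (Fin.ext h)

/-- The diagonal matrices with a sign in place `b` and `1` elsewhere. -/
def signDiagonals {d : ℕ} (b : Fin d) : Set (Matrix (Fin d) (Fin d) ℝ) :=
  {E | ∃ s : ℝ, |s| = 1 ∧ E = Matrix.diagonal (Function.update 1 b s)}

theorem fixingGroup_subset_signDiagonals {m : ℕ} :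
    fixingGroup (m + 2) (m + 1) ⊆ signDiagonals (Fin.last (m + 1)) := by
  intro W hW
  obtain ⟨h1, h2⟩ := fixingGroup_column (by omega) hW fun i hi => by have := i.2; omega
  refine ⟨W (Fin.last (m + 1)) (Fin.last (m + 1)), ?_, ?_⟩
  · rcases mul_self_eq_one_iff.1 h2 with h | h
    · exact (congrArg abs h).trans abs_one
    · exact (congrArg abs h).trans (by simp)
  · ext i l
    by_cases hl : l = Fin.last (m + 1)
    · subst hl
      by_cases hi : i = Fin.last (m + 1)
      · subst hi; simp
      · rw [Matrix.diagonal_apply_ne _ hi]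
        exact h1 i fun h => hi (Fin.ext h)
    · have hl' : (l : ℕ) < m + 1 := by
        have := l.2
        have h3 : (l : ℕ) ≠ m + 1 := fun h => hl (Fin.ext h)
        omega
      rw [hW.2 l hl' i]
      by_cases hi : i = l
      · subst hi; simp [hl]
      · rw [Matrix.one_apply_ne hi, Matrix.diagonal_apply_ne _ hi]

/-- Euler angles: an orthogonal matrix is a product of plane rotations, the last one in the plane of
the last two coordinates, and of a sign in the last coordinate. -/
theorem exists_rotation_cover (m j : ℕ) (hj : j ≤ m) :
    ∃ n, 2 * (n + 1) = (j + 2) * (j + 1) ∧ ∃ P : Set (Matrix (Fin (m + 2)) (Fin (m + 2)) ℝ),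
      SmoothlyCovered n P ∧ fixingGroup (m + 2) (m - j) ⊆
        P * Set.range (planeRotation (Fin.last m).castSucc (Fin.last (m + 1))) *
          signDiagonals (Fin.last (m + 1)) := by
  induction j with
  | zero =>
    refine ⟨0, rfl, {1}, smoothlyCovered_one _, fun U hU => ?_⟩
    obtain ⟨θ, W, hW, rfl, h0, hnn, -⟩ := exists_rotation_step (k := m) (by omega)
      (p := (Fin.last m).castSucc) (r := Fin.last (m + 1)) (Fin.castSucc_lt_last _).ne
      (by simp) (by simp) hU
    refine ⟨planeRotation _ _ θ, ⟨1, rfl, _, ⟨θ, rfl⟩, one_mul _⟩, W,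
      fixingGroup_subset_signDiagonals (mem_fixingGroup_succ (by omega) hW (fun i hi => ?_) hnn),
      rfl⟩
    have : i = Fin.last (m + 1) := Fin.ext (by have := i.2; simp; omega)
    rw [this]; exact h0
  | succ j ih =>
    obtain ⟨n, hn, P, hP, hsub⟩ := ih (by omega)
    -- Column m - (j + 1) has j + 2 entries below the diagonal, each costing one rotation. The
    -- single rotation in the last plane is never counted in n.
    obtain ⟨C, hC, h⟩ := exists_column_reduction (d := m + 2) (k := m - (j + 1)) (by omega) (j + 2)
      (by omega)
    refine ⟨j + 2 + n, by nlinarith, C * P, hC.mul hP, fun U hU => ?_⟩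
    obtain ⟨R, hR, W, hW, rfl, h0, hnn⟩ := h U hU
    have hW' := mem_fixingGroup_succ (by omega) hW (fun i hi => h0 i (by omega))
      (hnn (by omega) _ (by simp only []; omega))
    rw [show m - (j + 1) + 1 = m - j by omega] at hW'
    rw [mul_assoc, mul_assoc, ← mul_assoc P]
    exact Set.mul_mem_mul hR (hsub hW')

/-- On the plane of p and r the diagonal matrix is a multiple of the identity or of a reflection.
Rotations commute with the former; the latter reverses the angle. -/
theorem exists_planeRotation_mul_diagonal {d : ℕ} {p r : Fin d} (hpr : p ≠ r) (θ : ℝ)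
    (y : Fin d → ℝ) (hy : |y p| = |y r|) :
    ∃ φ, planeRotation p r θ * Matrix.diagonal y = Matrix.diagonal y * planeRotation p r φ := by
  have key : ∀ φ, Real.cos φ = Real.cos θ → Real.sin θ * y r = Real.sin φ * y p →
      Real.sin θ * y p = Real.sin φ * y r →
      planeRotation p r θ * Matrix.diagonal y = Matrix.diagonal y * planeRotation p r φ := by
    intro φ hc h1 h2
    ext a l
    rw [planeRotation_mul_apply, Matrix.diagonal_mul]
    simp only [planeRotation, Matrix.of_apply, Matrix.diagonal_apply, Matrix.one_apply, hc]
    by_cases ha : a = p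
    · subst ha
      by_cases hl : a = l
      · subst hl; simp [hpr.symm]; ring
      · by_cases hr : r = l
        · subst hr; simp [hpr]; linarith
        · simp [hl, hr]
    · by_cases har : a = r
      · subst har
        by_cases hl : p = l
        · subst hl; simp [ha]; linarith
        · by_cases hr : a = l
          · subst hr; simp [ha, hl]; ring
          · simp [hl, hr, ha]
      · by_cases hal : a = l
        · subst hal; simp [ha, har]
        · simp [ha, har, hal]
  rcases abs_eq_abs.1 hy with h | h
  · exact ⟨θ, key θ rfl (by rw [h]) (by rw [h])⟩
  · refine ⟨-θ, key _ (Real.cos_neg θ) ?_ ?_⟩ <;> rw [Real.sin_neg, h] <;> ring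

theorem smoothlyCovered_diagonal (m : ℕ) (ε : ℝ) :
    SmoothlyCovered (m + 1) {D : Matrix (Fin (m + 2)) (Fin (m + 2)) ℝ |
      ∃ y : Fin (m + 2) → ℝ, y (Fin.last (m + 1)) = ε * y (Fin.last m).castSucc ∧
        D = Matrix.diagonal y} := by
  refine ⟨fun z => Matrix.diagonal (Fin.snoc z (ε * z (Fin.last m))),
    contDiff_matrix fun i j => ?_, ?_⟩
  · by_cases h : i = j
    · subst h
      simp only [Matrix.diagonal_apply_eq]
      induction i using Fin.lastCases with
      | last => simp only [Fin.snoc_last]; fun_prop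
      | cast i => simp only [Fin.snoc_castSucc]; fun_prop
    · simp only [Matrix.diagonal_apply_ne _ h]
      exact contDiff_const
  · rintro _ ⟨y, hy, rfl⟩
    refine ⟨fun i => y i.castSucc, ?_⟩
    refine congrArg Matrix.diagonal (funext fun i => ?_)
    induction i using Fin.lastCases with
    | last => simp [hy]
    | cast i => simp

theorem signDiagonals_transpose {d : ℕ} {b : Fin d} {E : Matrix (Fin d) (Fin d) ℝ}
    (hE : E ∈ signDiagonals b) : Eᵀ = E := by
  obtain ⟨s, -, rfl⟩ := hE
  exact Matrix.diagonal_transpose _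

theorem signDiagonals_mul_diagonal {d : ℕ} {b : Fin d} {E : Matrix (Fin d) (Fin d) ℝ}
    (hE : E ∈ signDiagonals b) (y : Fin d → ℝ) :
    ∃ z : Fin d → ℝ, (∀ i, |z i| = |y i|) ∧ E * Matrix.diagonal y = Matrix.diagonal z ∧
      Matrix.diagonal y * E = Matrix.diagonal z := by
  obtain ⟨s, hs, rfl⟩ := hE
  refine ⟨fun i => Function.update (1 : Fin d → ℝ) b s i * y i, fun i => ?_, ?_, ?_⟩
  · by_cases h : i = b
    · subst h; simp [abs_mul, hs]
    · simp [h]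
  · rw [Matrix.diagonal_mul_diagonal]
  · rw [Matrix.diagonal_mul_diagonal]
    congr 1; ext i; exact mul_comm _ _

theorem exists_eq_of_mem_singularLocus {m : ℕ}
    {q : Matrix (Fin (m + 2)) (Fin (m + 2)) ℝ} (hq : q ∈ singularLocus (m + 2)) :
    (Matrix.toEuclideanLin q).singularValues m =
      (Matrix.toEuclideanLin q).singularValues (m + 1) := by
  obtain ⟨U, hU, V, hV, h⟩ := exists_singular_value_decomposition q
  set T := Matrix.toEuclideanLin q
  rw [h, mem_singularLocus_iff (by omega) hU hV] at hq
  by_contra hne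
  refine hq ⟨Fin.last (m + 1), fun j hj => ?_⟩
  rw [abs_of_nonneg (T.singularValues_nonneg _), abs_of_nonneg (T.singularValues_nonneg _)]
  have h1 : (j : ℕ) ≤ m := by
    have := j.2
    have h3 : (j : ℕ) ≠ m + 1 := fun h => hj (Fin.ext h)
    omega
  exact ((T.singularValues_antitone (Nat.le_succ m)).lt_of_ne (Ne.symm hne)).trans_le
    (T.singularValues_antitone h1)

/-- In U = p R(θ) E the sign E is absorbed into the diagonal and R(θ) passes through it into V, so
the left factor costs n parameters and the right one n + 1. With m + 1 for the diagonal and 2 (n +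
1) = (m + 2)(m + 1) the total is d² - 2 for d = m + 2. -/
theorem dimH_singularLocus_le (m : ℕ) :
    dimH (singularLocus (m + 2)) ≤ ((m ^ 2 + 4 * m + 2 : ℕ) : ENNReal) := by
  obtain ⟨n, hn, P, hP, hsub⟩ := exists_rotation_cover m m le_rfl
  rw [Nat.sub_self] at hsub
  set a : Fin (m + 2) := (Fin.last m).castSucc
  set b : Fin (m + 2) := Fin.last (m + 1)
  have hab : a ≠ b := (Fin.castSucc_lt_last _).ne
  have horth : ∀ U ∈ Matrix.orthogonalGroup (Fin (m + 2)) ℝ, U ∈ fixingGroup (m + 2) 0 :=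
    fun U hU => ⟨hU, fun l hl => absurd hl (Nat.not_lt_zero _)⟩
  set Q := P * Set.range (planeRotation a b) with hQ
  have hQc : SmoothlyCovered (n + 1) Q := hP.mul (smoothlyCovered_planeRotation a b)
  set D : ℝ → Set (Matrix (Fin (m + 2)) (Fin (m + 2)) ℝ) := fun ε => {D | ∃ y : Fin (m + 2) → ℝ,
    y b = ε * y a ∧ D = Matrix.diagonal y} with hD
  have hcov : ∀ ε, SmoothlyCovered (n + (m + 1) + (n + 1)) (P * D ε * (Matrix.transpose '' Q)) :=
    fun ε => (hP.mul (smoothlyCovered_diagonal m ε)).mul hQc.transpose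
  have hN : n + (m + 1) + (n + 1) = m ^ 2 + 4 * m + 2 := by nlinarith
  rw [hN] at hcov
  have hmem : singularLocus (m + 2) ⊆
      P * D 1 * (Matrix.transpose '' Q) ∪ P * D (-1) * (Matrix.transpose '' Q) := by
    intro q hq
    have heq := exists_eq_of_mem_singularLocus hq
    obtain ⟨U, hU, V, hV, h⟩ := exists_singular_value_decomposition q
    set σ : Fin (m + 2) → ℝ := fun i => (Matrix.toEuclideanLin q).singularValues i with hσ
    have hσab : σ a = σ b := heq
    obtain ⟨_, ⟨p, hp, _, ⟨θ, rfl⟩, rfl⟩, E, hE, rfl⟩ := hsub (horth U hU)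
    obtain ⟨y, hy, hEy, -⟩ := signDiagonals_mul_diagonal hE σ
    obtain ⟨φ, hφ⟩ := exists_planeRotation_mul_diagonal hab θ y (by rw [hy, hy, hσab])
    -- The transpose is decomposed so that its sign factor ends up next to the diagonal matrix.
    have hW : (planeRotation a b φ * V)ᵀ ∈ Matrix.orthogonalGroup (Fin (m + 2)) ℝ := by
      rw [Matrix.mem_orthogonalGroup_iff]
      rw [Matrix.transpose_transpose]
      exact transpose_mul_self_of_mem (mul_mem (planeRotation_mem hab φ) hV)
    obtain ⟨G, hG, F, hF, hGF⟩ := hsub (horth _ hW)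
    obtain ⟨z, hz, -, hFz⟩ := signDiagonals_mul_diagonal hF y
    have hWV : planeRotation a b φ * V = F * Gᵀ := by
      rw [← Matrix.transpose_transpose (planeRotation a b φ * V), ← hGF]
      simp only [Matrix.transpose_mul, signDiagonals_transpose hF]
    have hq' : q = p * Matrix.diagonal z * Gᵀ := by
      rw [h]
      calc p * planeRotation a b θ * E * Matrix.diagonal σ * V
          = p * (planeRotation a b θ * (E * Matrix.diagonal σ)) * V := by simp only [mul_assoc]
        _ = p * Matrix.diagonal y * (planeRotation a b φ * V) := by
            rw [hEy, hφ]; simp only [mul_assoc]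
        _ = p * (Matrix.diagonal y * F) * Gᵀ := by rw [hWV]; simp only [mul_assoc]
        _ = _ := by rw [hFz]
    have hzab : |z b| = |z a| := by rw [hz, hz, hy, hy, hσab]
    rw [hq']
    rcases abs_eq_abs.1 hzab with h1 | h1
    · exact Or.inl (Set.mul_mem_mul (Set.mul_mem_mul hp ⟨z, by rw [h1, one_mul], rfl⟩) ⟨G, hG, rfl⟩)
    · exact Or.inr (Set.mul_mem_mul (Set.mul_mem_mul hp ⟨z, by rw [h1, neg_one_mul], rfl⟩)
        ⟨G, hG, rfl⟩)
  refine (dimH_mono hmem).trans ?_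
  rw [dimH_union]
  exact max_le (hcov 1).dimH_le (hcov (-1)).dimH_le

/-! ### Lower bound for the dimension: a surjective derivative -/

section

attribute [local instance] Matrix.frobeniusNormedRing Matrix.frobeniusNormedAlgebra

theorem exp_sub_transpose_mem {d : ℕ} (X : Matrix (Fin d) (Fin d) ℝ) :
    NormedSpace.exp (X - Xᵀ) ∈ Matrix.orthogonalGroup (Fin d) ℝ := by
  rw [Matrix.mem_orthogonalGroup_iff]
  change _ * (NormedSpace.exp (X - Xᵀ))ᵀ = 1
  have h : (X - Xᵀ)ᵀ = -(X - Xᵀ) := by simp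
  rw [← Matrix.exp_transpose, h, ← Matrix.exp_add_of_commute _ _ (Commute.refl (X - Xᵀ)).neg_right]
  simp

/-- The skew-symmetric matrix `X - Xᵀ` as a linear function of `X`. -/
noncomputable def skewPart (d : ℕ) :
    Matrix (Fin d) (Fin d) ℝ →L[ℝ] Matrix (Fin d) (Fin d) ℝ :=
  LinearMap.toContinuousLinearMap
    (LinearMap.id - (Matrix.transposeLinearEquiv (Fin d) (Fin d) ℝ ℝ).toLinearMap)

theorem skewPart_apply {d : ℕ} (X : Matrix (Fin d) (Fin d) ℝ) : skewPart d X = X - Xᵀ := rfl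

theorem hasStrictFDerivAt_exp_skewPart {E : Type*} [NormedAddCommGroup E] [NormedSpace ℝ E] {d : ℕ}
    (p : E →L[ℝ] Matrix (Fin d) (Fin d) ℝ) {z : E} (hz : p z = 0) :
    HasStrictFDerivAt (fun z => NormedSpace.exp (skewPart d (p z))) (skewPart d ∘L p) z := by
  have h1 : HasStrictFDerivAt (fun z => skewPart d (p z)) (skewPart d ∘L p) z :=
    (skewPart d ∘L p).hasStrictFDerivAt
  have h2 : HasStrictFDerivAt (NormedSpace.exp : Matrix (Fin d) (Fin d) ℝ → _)
      (ContinuousLinearMap.id ℝ (Matrix (Fin d) (Fin d) ℝ)) (skewPart d (p z)) := by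
    rw [hz, map_zero]
    exact hasStrictFDerivAt_exp_zero
  exact (h2.comp z h1).congr_fderiv rfl

theorem exists_hasStrictFDerivAt_exp_mul_exp {E : Type*} [NormedAddCommGroup E] [NormedSpace ℝ E]
    {d : ℕ} (p r g : E →L[ℝ] Matrix (Fin d) (Fin d) ℝ) {z : E} (hp : p z = 0) (hr : r z = 0) :
    ∃ f' : E →L[ℝ] Matrix (Fin d) (Fin d) ℝ,
      HasStrictFDerivAt (fun z => NormedSpace.exp (skewPart d (p z)) * g z *
        NormedSpace.exp (skewPart d (r z))) f' z ∧
      ∀ w, f' w = skewPart d (p w) * g z + g w + g z * skewPart d (r w) := by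
  have h1 := hasStrictFDerivAt_exp_skewPart p hp
  have h2 := hasStrictFDerivAt_exp_skewPart r hr
  refine ⟨_, (h1.mul' g.hasStrictFDerivAt).mul' h2, fun w => ?_⟩
  change (NormedSpace.exp (skewPart d (p z)) * g z) * skewPart d (r w) +
    (NormedSpace.exp (skewPart d (p z)) * g w + skewPart d (p w) * g z) *
      NormedSpace.exp (skewPart d (r z)) = _
  rw [hp, hr, map_zero, NormedSpace.exp_zero, one_mul, one_mul, mul_one]
  abel

end

/-- Repeating the last entry of a vector. -/
def repeatLast (m : ℕ) : Fin (m + 2) → Fin (m + 1) :=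
  fun i => Fin.lastCases (motive := fun _ => Fin (m + 1)) (Fin.last m) id i

theorem repeatLast_last (m : ℕ) : repeatLast m (Fin.last (m + 1)) = Fin.last m := by
  simp [repeatLast]

theorem repeatLast_castSucc (m : ℕ) (i : Fin (m + 1)) : repeatLast m i.castSucc = i := by
  simp [repeatLast]

/-- The matrix entries other than the last two of the last column. -/
abbrev FreeEntries (m : ℕ) : Type :=
  {p : Fin (m + 2) × Fin (m + 2) // p ∉ ({(Fin.last (m + 1), Fin.last (m + 1)),
    ((Fin.last m).castSucc, Fin.last (m + 1))} : Finset (Fin (m + 2) × Fin (m + 2)))}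

theorem card_freeEntries (m : ℕ) : Fintype.card (FreeEntries m) = m ^ 2 + 4 * m + 2 := by
  rw [Fintype.card_subtype_compl, Fintype.card_prod, Fintype.card_fin, Fintype.card_coe,
    Finset.card_pair]
  · have : (m + 2) * (m + 2) = m ^ 2 + 4 * m + 2 + 2 := by ring
    omega
  · simp only [ne_eq, Prod.mk.injEq, and_true]
    exact (Fin.castSucc_lt_last _).ne'

/-- The projection of a matrix to its free entries. -/
noncomputable def freeEntries (m : ℕ) :
    Matrix (Fin (m + 2)) (Fin (m + 2)) ℝ →L[ℝ] (FreeEntries m → ℝ) :=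
  LinearMap.toContinuousLinearMap
    (LinearMap.pi fun k : FreeEntries m => Matrix.entryLinearMap ℝ ℝ k.1.1 k.1.2)

theorem freeEntries_apply {m : ℕ} (q : Matrix (Fin (m + 2)) (Fin (m + 2)) ℝ) (k : FreeEntries m) :
    freeEntries m q k = q k.1.1 k.1.2 := rfl

/-- Diagonal matrices whose last two entries agree. -/
noncomputable def repeatedDiagonal (m : ℕ) :
    (Fin (m + 1) → ℝ) →L[ℝ] Matrix (Fin (m + 2)) (Fin (m + 2)) ℝ :=
  LinearMap.toContinuousLinearMap
    (Matrix.diagonalLinearMap (Fin (m + 2)) ℝ ℝ ∘ₗ LinearMap.funLeft ℝ ℝ (repeatLast m))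

theorem repeatedDiagonal_apply {m : ℕ} (x : Fin (m + 1) → ℝ) :
    repeatedDiagonal m x = Matrix.diagonal (fun i => x (repeatLast m i)) := rfl

/-- The vector `m + 1, m, …, 1`. -/
def descendingVector (m : ℕ) : Fin (m + 1) → ℝ := fun i => (m : ℝ) + 1 - (i : ℕ)

theorem descendingVector_pos {m : ℕ} (i : Fin (m + 1)) : 0 < descendingVector m i := by
  have : ((i : ℕ) : ℝ) < m + 1 := by exact_mod_cast i.2
  simp only [descendingVector]; linarith

theorem descendingVector_strictAnti {m : ℕ} {i j : Fin (m + 1)} (h : i < j) :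
    descendingVector m j < descendingVector m i := by
  have : ((i : ℕ) : ℝ) < ((j : ℕ) : ℝ) := by exact_mod_cast h
  simp only [descendingVector]; linarith

/-- At the base point the repeated last entry is strictly below all the others, so it stays minimal
nearby. -/
theorem eventually_repeatedDiagonal_mem (m : ℕ) :
    ∀ᶠ x in nhds (descendingVector m), ∀ U ∈ Matrix.orthogonalGroup (Fin (m + 2)) ℝ,
      ∀ V ∈ Matrix.orthogonalGroup (Fin (m + 2)) ℝ,
        U * repeatedDiagonal m x * V ∈ singularLocus (m + 2) := by
  have h : ∀ i : Fin (m + 1), ∀ᶠ x in nhds (descendingVector m), |x (Fin.last m)| ≤ |x i| := by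
    intro i
    by_cases hi : i = Fin.last m
    · rw [hi]; exact Filter.Eventually.of_forall fun x => le_rfl
    · have hlt : |descendingVector m (Fin.last m)| < |descendingVector m i| := by
        rw [abs_of_pos (descendingVector_pos _), abs_of_pos (descendingVector_pos _)]
        exact descendingVector_strictAnti (Fin.lt_last_iff_ne_last.2 hi)
      have hc : ∀ j : Fin (m + 1), ContinuousAt (fun x : Fin (m + 1) → ℝ => |x j|)
          (descendingVector m) := fun j => (continuous_apply j).abs.continuousAt
      exact ((hc _).eventually_lt (hc i) hlt).mono fun x => le_of_lt
  filter_upwards [Filter.eventually_all.2 h] with x hx U hU V hV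
  rw [repeatedDiagonal_apply]
  refine mem_singularLocus_of_eq hU hV _ (b := Fin.last (m + 1)) (j := (Fin.last m).castSucc)
    (fun i => ?_) (Fin.castSucc_lt_last _).ne ?_
  · simp only [repeatLast_last]; exact hx _
  · simp only [repeatLast_last, repeatLast_castSucc]

theorem skewPart_single_mul_diagonal {d : ℕ} (i j : Fin d) (c : ℝ) (y : Fin d → ℝ) :
    skewPart d (Matrix.single i j c) * Matrix.diagonal y =
      Matrix.single i j (c * y j) - Matrix.single j i (c * y i) := by
  rw [skewPart_apply, Matrix.transpose_single, sub_mul]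
  ext a b
  simp only [Matrix.sub_apply, Matrix.mul_diagonal, Matrix.single_apply, ite_mul, zero_mul]
  grind

theorem diagonal_mul_skewPart_single {d : ℕ} (i j : Fin d) (c : ℝ) (y : Fin d → ℝ) :
    Matrix.diagonal y * skewPart d (Matrix.single i j c) =
      Matrix.single i j (y i * c) - Matrix.single j i (y j * c) := by
  rw [skewPart_apply, Matrix.transpose_single, mul_sub]
  ext a b
  simp only [Matrix.sub_apply, Matrix.diagonal_mul, Matrix.single_apply, mul_ite, mul_zero]
  grind

/-- Tangent directions fill every entry off the last 2 × 2 block. Inside that block, where the two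
values coincide, only scalar and skew directions occur, and the two discarded entries are exactly
what these cannot reach independently. -/
theorem exists_freeEntries_eq_single {m : ℕ} (k : FreeEntries m) :
    ∃ X Y : Matrix (Fin (m + 2)) (Fin (m + 2)) ℝ, ∃ x, ∃ c : ℝ, c ≠ 0 ∧
      freeEntries m (skewPart _ X * repeatedDiagonal m (descendingVector m) + repeatedDiagonal m x +
        repeatedDiagonal m (descendingVector m) * skewPart _ Y) = c • Pi.single k 1 := by
  obtain ⟨⟨i, j⟩, hk⟩ := k
  simp only [Finset.mem_insert, Finset.mem_singleton, Prod.mk.injEq, not_or, not_and] at hk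
  have hsingle : ∀ c : ℝ, freeEntries m (Matrix.single i j c) =
      c • Pi.single (⟨(i, j), by simpa using hk⟩ : FreeEntries m) 1 := fun c => by
    ext ⟨⟨i', j'⟩, h'⟩
    rw [freeEntries_apply]
    by_cases h : i = i' ∧ j = j'
    · obtain ⟨rfl, rfl⟩ := h; simp
    · rw [Matrix.single_apply_of_ne _ _ _ _ _ h]
      simp only [Pi.smul_apply, smul_eq_mul]
      rw [Pi.single_eq_of_ne, mul_zero]
      intro he
      simp only [Subtype.mk.injEq, Prod.mk.injEq] at he
      exact h ⟨he.1.symm, he.2.symm⟩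
  set y : Fin (m + 2) → ℝ := fun i => descendingVector m (repeatLast m i) with hy
  have hD : repeatedDiagonal m (descendingVector m) = Matrix.diagonal y := rfl
  have hpos : ∀ i, 0 < y i := fun i => descendingVector_pos _
  rw [hD]
  by_cases hij : i = j
  · subst hij
    have hi : i ≠ Fin.last (m + 1) := fun h => hk.1 h h
    obtain ⟨l, rfl⟩ := Fin.exists_castSucc_eq.2 hi
    -- If l is the last index, both repeated diagonal entries move, but the second one is not free.
    refine ⟨0, 0, Pi.single l 1, 1, one_ne_zero, ?_⟩
    rw [map_zero, zero_mul, mul_zero, zero_add, add_zero, ← hsingle]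
    ext ⟨⟨i', j'⟩, h'⟩
    rw [freeEntries_apply, freeEntries_apply, repeatedDiagonal_apply]
    simp only [Finset.mem_insert, Finset.mem_singleton, Prod.mk.injEq, not_or, not_and] at h'
    by_cases h : i' = j'
    · subst h
      have hi' : i' ≠ Fin.last (m + 1) := fun h => h'.1 h h
      obtain ⟨l', rfl⟩ := Fin.exists_castSucc_eq.2 hi'
      simp only [Matrix.diagonal_apply_eq, repeatLast_castSucc, Matrix.single_apply]
      by_cases hl : l = l'
      · subst hl; simp
      · simp [hl, Ne.symm hl]
    · rw [Matrix.diagonal_apply_ne _ h, Matrix.single_apply_of_ne]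
      rintro ⟨h1, h2⟩
      exact h (h1.symm.trans h2)
  · by_cases hlast : i = Fin.last (m + 1) ∧ j = (Fin.last m).castSucc
    -- Here y i = y j and only the skew direction is available; its (j, i) entry is discarded by the
    -- projection.
    · refine ⟨Matrix.single i j 1, 0, 0, y j, (hpos j).ne', ?_⟩
      rw [map_zero, map_zero, mul_zero, add_zero, add_zero, skewPart_single_mul_diagonal, map_sub,
        one_mul, hsingle]
      have : freeEntries m (Matrix.single j i (1 * y i)) = 0 := by
        ext ⟨⟨i', j'⟩, h'⟩
        rw [freeEntries_apply, Matrix.single_apply_of_ne]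
        · rfl
        · rintro ⟨h1, h2⟩
          simp only at h1 h2
          subst h1 h2
          rw [hlast.1, hlast.2] at h'
          simp at h'
      rw [this, sub_zero]
    · have hne : y i ≠ y j := by
        have hinj : repeatLast m i ≠ repeatLast m j := by
          induction i using Fin.lastCases with
          | last =>
            induction j using Fin.lastCases with
            | last => exact absurd rfl hij
            | cast j =>
              rw [repeatLast_last, repeatLast_castSucc]
              rintro rfl
              exact hlast ⟨rfl, rfl⟩
          | cast i =>
            induction j using Fin.lastCases with
            | last =>
              rw [repeatLast_last, repeatLast_castSucc]
              rintro rfl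
              exact hk.2 rfl rfl
            | cast j =>
              rw [repeatLast_castSucc, repeatLast_castSucc]
              rintro rfl
              exact hij rfl
        rcases hinj.lt_or_gt with h | h
        · exact (descendingVector_strictAnti h).ne'
        · exact (descendingVector_strictAnti h).ne
      -- The multiples y j and -y i make the (j, i) entries cancel and leave y j ^ 2 - y i ^ 2 at
      -- (i, j).
      refine ⟨Matrix.single i j (y j), Matrix.single i j (-y i), 0, y j * y j - y i * y i, ?_, ?_⟩
      · intro h
        have h1 : (y j - y i) * (y j + y i) = 0 := by linear_combination h
        rcases mul_eq_zero.1 h1 with h2 | h2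
        · exact hne (by linarith)
        · linarith [hpos i, hpos j]
      · rw [map_zero, add_zero, skewPart_single_mul_diagonal, diagonal_mul_skewPart_single,
          ← hsingle]
        congr 1
        ext i' j'
        simp only [Matrix.add_apply, Matrix.sub_apply, Matrix.single_apply]
        split_ifs <;> ring

/-- A surjective strict derivative makes the parametrisation followed by `freeEntries` open at z.
The projection of the locus therefore contains an open set of dimension d² - 2 with d = m + 2, and a
Lipschitz map does not raise Hausdorff dimension. -/
theorem le_dimH_singularLocus (m : ℕ) :
    ((m ^ 2 + 4 * m + 2 : ℕ) : ENNReal) ≤ dimH (singularLocus (m + 2)) := by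
  let M := Matrix (Fin (m + 2)) (Fin (m + 2)) ℝ
  let E := M × M × (Fin (m + 1) → ℝ)
  let p : E →L[ℝ] M := ContinuousLinearMap.fst ℝ M (M × (Fin (m + 1) → ℝ))
  let r : E →L[ℝ] M := ContinuousLinearMap.fst ℝ M (Fin (m + 1) → ℝ) ∘L
    ContinuousLinearMap.snd ℝ M (M × (Fin (m + 1) → ℝ))
  let t : E →L[ℝ] (Fin (m + 1) → ℝ) := ContinuousLinearMap.snd ℝ M (Fin (m + 1) → ℝ) ∘L
    ContinuousLinearMap.snd ℝ M (M × (Fin (m + 1) → ℝ))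
  let z : E := (0, 0, descendingVector m)
  obtain ⟨f', hf', hf'_apply⟩ := exists_hasStrictFDerivAt_exp_mul_exp p r
    (repeatedDiagonal m ∘L t) (z := z) rfl rfl
  have hstrict := (freeEntries m).hasStrictFDerivAt.comp z hf'
  have hsurj : (freeEntries m ∘L f').range = ⊤ := by
    rw [eq_top_iff]
    rintro v -
    rw [← Finset.univ_sum_single v]
    refine Submodule.sum_mem _ fun k _ => ?_
    obtain ⟨X, Y, x, c, hc, h⟩ := exists_freeEntries_eq_single k
    have hmem : c • (Pi.single k 1 : FreeEntries m → ℝ) ∈ (freeEntries m ∘L f').range :=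
      ⟨(X, Y, x), by
        rw [← h]
        exact congrArg (freeEntries m) (hf'_apply (X, Y, x))⟩
    have hmem' := Submodule.smul_mem _ (v k * c⁻¹) hmem
    rw [smul_smul, mul_assoc, inv_mul_cancel₀ hc, mul_one, ← Pi.single_smul'] at hmem'
    simpa using hmem'
  have : CompleteSpace E := FiniteDimensional.complete ℝ E
  have hmap := hstrict.map_nhds_eq_of_surj hsurj
  have hev : ∀ᶠ w in nhds z, NormedSpace.exp (skewPart _ (p w)) * repeatedDiagonal m (t w) *
      NormedSpace.exp (skewPart _ (r w)) ∈ singularLocus (m + 2) := by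
    have h1 : ∀ᶠ w in nhds z, _ :=
      t.continuous.continuousAt.eventually (eventually_repeatedDiagonal_mem m)
    filter_upwards [h1] with w hw
    exact hw _ (exp_sub_transpose_mem _) _ (exp_sub_transpose_mem _)
  have hnhds : freeEntries m '' singularLocus (m + 2) ∈ nhds (freeEntries m
      (NormedSpace.exp (skewPart _ (p z)) * repeatedDiagonal m (t z) *
        NormedSpace.exp (skewPart _ (r z)))) := by
    refine hmap ▸ Filter.mem_map.2 ?_
    filter_upwards [hev] with w hw
    exact ⟨_, hw, rfl⟩
  have hdim := Real.dimH_of_mem_nhds hnhds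
  rw [Module.finrank_fintype_fun_eq_card, card_freeEntries] at hdim
  rw [← hdim]
  exact (freeEntries m).lipschitz.dimH_image_le _

theorem singularLocus_hasCodimension (m : ℕ) : HasCodimension (singularLocus (m + 2)) 2 := by
  rw [HasCodimension, le_antisymm (dimH_singularLocus_le m) (le_dimH_singularLocus m),
    Module.finrank_matrix]
  simp only [Fintype.card_fin, Module.finrank_self, mul_one]
  norm_cast
  ring

end SignedDistance

theorem mainTheorem6 (d : ℕ) (hd : 2 ≤ d) :
    (∀ q : Matrix (Fin d) (Fin d) ℝ,
      SignedDistance.principalValue q (d - 1) ≠ SignedDistance.principalValue q d →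
        ContDiffAt ℝ ∞ (SignedDistance.signedDist d) q) ∧
    SignedDistance.singularLocus d =
      {q | SignedDistance.principalValue q (d - 1) = SignedDistance.principalValue q d} ∧
    SignedDistance.singularLocus d =
      {q | ∃ x : Fin d → ℝ, SignedDistance.IsSignedSingularValues q x ∧
        x ⟨d - 2, by omega⟩ = |x ⟨d - 1, by omega⟩|} ∧
    SignedDistance.IsSemialgebraicMatrixSet (SignedDistance.singularLocus d) ∧
    SignedDistance.HasCodimension (SignedDistance.singularLocus d) 2 := by
  obtain ⟨m, rfl⟩ : ∃ m, d = m + 2 := ⟨d - 2, by omega⟩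
  -- The three descriptions of the locus are compared by a cycle of inclusions h1, h2, h3.
  have h1 : SignedDistance.singularLocus (m + 2) ⊆
    {q | SignedDistance.principalValue q (m + 2 - 1) =
      SignedDistance.principalValue q (m + 2)} := fun q hq =>
    SignedDistance.exists_eq_of_mem_singularLocus hq
  have h2 : {q : Matrix (Fin (m + 2)) (Fin (m + 2)) ℝ |
    SignedDistance.principalValue q (m + 2 - 1) =
      SignedDistance.principalValue q (m + 2)} ⊆ {q | ∃ x : Fin (m + 2) → ℝ,
        SignedDistance.IsSignedSingularValues q x ∧
          x ⟨m + 2 - 2, by omega⟩ = |x ⟨m + 2 - 1, by omega⟩|} := fun q hq => by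
    obtain ⟨x, hx, habs⟩ := SignedDistance.exists_isSignedSingularValues (Fin.last (m + 1))
      Fin.le_last q
    have hlt : (⟨m + 2 - 2, by omega⟩ : Fin (m + 2)) < ⟨m + 2 - 1, by omega⟩ :=
      Fin.mk_lt_mk.2 (by omega)
    refine ⟨x, hx, ?_⟩
    rw [← abs_of_nonneg ((abs_nonneg _).trans (hx.1 _ _ hlt)), habs, habs]
    exact hq
  have h3 : {q : Matrix (Fin (m + 2)) (Fin (m + 2)) ℝ | ∃ x : Fin (m + 2) → ℝ,
        SignedDistance.IsSignedSingularValues q x ∧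
          x ⟨m + 2 - 2, by omega⟩ = |x ⟨m + 2 - 1, by omega⟩|} ⊆
      SignedDistance.singularLocus (m + 2) := by
    rintro _ ⟨x, ⟨hx, U, hU, V, hV, rfl⟩, heq⟩
    have hlt : (⟨m + 2 - 2, by omega⟩ : Fin (m + 2)) < ⟨m + 2 - 1, by omega⟩ :=
      Fin.mk_lt_mk.2 (by omega)
    refine SignedDistance.mem_singularLocus_of_eq
      (Matrix.mem_specialOrthogonalGroup_iff.1 hU).1 (Matrix.mem_specialOrthogonalGroup_iff.1 hV).1
      x (b := ⟨m + 2 - 1, by omega⟩) (j := ⟨m + 2 - 2, by omega⟩) (fun i => ?_) hlt.ne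
      (by rw [heq, abs_abs])
    rcases (show i ≤ ⟨m + 2 - 1, by omega⟩ from Fin.le_last i).eq_or_lt with h | h
    · rw [h]
    · exact (hx _ _ h).trans (le_abs_self _)
  refine ⟨fun q hq => ?_, h1.antisymm (h2.trans h3), (h1.trans h2).antisymm h3,
    SignedDistance.isSemialgebraicMatrixSet_singularLocus (by omega),
    SignedDistance.singularLocus_hasCodimension m⟩
  by_contra hns
  exact hq (h1 hns)
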